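/- Let $\mathbb F_q$ be a finite field, $A=\mathbb F_q[T]$, let $j,k\ge 1$ be coprime integers, $m=j+k$ and $n\ge 1$. Let $L\supseteq\mathbb F_{q^m}$ be a field with algebraic closure $\bar L$, and let $\tau$ be the $q$-Frobenius. We consider Drinfeld modules $\phi$ of the form $\phi_T=g_m\tau^m+g_j\tau^j+1$ with $g_m\ne 0$; $\phi$ is called normalized if $g_m=-1$. For such $\phi$ let $\mathcal G_n(\phi)$ be the set of $A$-submodules $G\subseteq\operatorname{Ker}(\phi_{T^n})\subseteq\bar L$ with $G\cong A/(T^n)$ as $A$-modules ($A$ acting on $\bar L$ through $\phi$) that are stable under $\operatorname{Aut}(\bar L/L)$ (no condition when $L=\bar L$). Consider the following affine curves over $\mathbb F_{q^m}$, described by their $L$-points: - $\ddot X=\ddot X_{m,j}(T^n)$: triples $(\phi,G,x)$ with $\phi$ normalized over $L$, $G\in\mathcal G_n(\phi)$ and $0\neq x\in G\cap\operatorname{Ker}(\phi_T)\cap L$; its regular functions are generated over $\mathbb F_{q^m}$ by $g_j$, $x$ and the coefficients of $\prod_{v\in G}(Z-v)$; - $\dot X=\dot X_{m,j}(T^n)$: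 pairs $(\phi,G)$ with $\phi$ normalized over $L$ and $G\in\mathcal G_n(\phi)$; its regular functions are generated over $\mathbb F_{q^m}$ by $g_j$ and the coefficients of $\prod_{v\in G}(Z-v)$; - $X=X_{m,j}(T^n)$: classes $[(\phi,G)]$ of pairs with $\phi$ over $L$ as above (not necessarily normalized) and $G\in\mathcal G_n(\phi)$, where $(\phi,G)\sim(\phi',G')$ if there is $\lambda\in\bar L^*$ with $\lambda\phi_T=\phi'_T\lambda$ and $\lambda G=G'$; its regular functions are the isomorphism-invariant polynomials over $\mathbb F_{q^m}$ in $g_m,g_m^{-1},g_j$ and the coefficients of $\prod_{v\in G}(Z-v)$. (In particular these are affine curves over $\mathbb F_{q^m}$ whose $L$-points are as described.) Let $\pi_1:\ddot X\to\dot X$, $(\phi,G,x)\mapsto(\phi,G)$, and $\pi_3:\ddot X\to X$, $(\phi,G,x)\mapsto[(\phi,G)]$. For $0\ne y\in\bar L$ let $\phi^y$ be the normalized Drinfeld module with $\phi^y_T(y)=0$, i.e. with $g_j=y^{q^m-q^j}-y^{1-q^j}$. For $\mu\in\mathbb F_{q^m}^*$ let $\mu:\ddot X\to\ddot X$ be the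 map $(\phi,G,x)\mapsto(\phi^{\mu x},\mu G,\mu x)$. Then: 1. Each $\mu\in\mathbb F_{q^m}^*$ is an automorphism of $\ddot X$ over $\mathbb F_{q^m}$ and $\pi_3\circ\mu=\pi_3$. If $\mu\in\mathbb F_q^*$, then moreover $\pi_1\circ\mu=\pi_1$. 2. $\pi_1:\ddot X\to\dot X$ is a Galois covering with group $\mathbb F_q^*$. 3. $\pi_3:\ddot X\to X$ is a Galois covering with group $\mathbb F_{q^m}^*$. Here a surjective morphism $\pi:Y\to Z$ of affine curves over $\mathbb F_{q^m}$ is called a Galois covering with group $\Gamma$ if $\Gamma$ acts on $Y$ by automorphisms over $\mathbb F_{q^m}$ (here, by the scalings $\mu$), acts simply transitively on every geometric fibre of $\pi$, and the regular functions on $Z$ are exactly the $\Gamma$-invariant regular functions on $Y$. In particular, whenever the curves are irreducible, the corresponding extension of function fields is Galois with Galois group isomorphic to $\Gamma$. -/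

import Mathlib

open Polynomial

universe u v w

set_option linter.unusedSectionVars false

noncomputable section

namespace DrinfeldCurve

/-! ### Drinfeld modules of the form `φ_T = g_m τ^m + g_j τ^j + 1` and their level structures

`Fq` is the finite field with `q` elements, `A = Fq[X]` (the variable `X` is `T`), and `Ω` is an
algebraically closed field containing `Fq`. Since `Ω` is infinite, `Ω{τ}` acts faithfully on `Ω`,
and twisted polynomials are written as `Fq`-linear endomorphisms of `Ω`; the product of `Ω{τ}` is
the composition. -/

section Points

variable (Fq : Type u) [Field Fq] [Fintype Fq] {Ω : Type w} [Field Ω] [Algebra Fq Ω]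

/-- The `q`-Frobenius `τ`. -/
def tau : Module.End Fq Ω := (FiniteField.frobeniusAlgHom Fq Ω).toLinearMap

/-- `φ_T = g_m τ^m + g_j τ^j + 1`; the Drinfeld module is the `Fq`-algebra homomorphism
`φ : A → Ω{τ}`, `a ↦ φ_a := aeval φ_T a`, determined by `φ_T`. -/
def phiT (m j : ℕ) (gm gj : Ω) : Module.End Fq Ω := gm • tau Fq ^ m + gj • tau Fq ^ j + 1

/-- Multiplication by the scalar `c ∈ Ω`, as an element of `Ω{τ}`. -/
def scalar (c : Ω) : Module.End Fq Ω := LinearMap.mulLeft Fq c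

/-- `G ⊆ Ker φ_N` is an `A`-submodule of `Ω` isomorphic to `A / N A`, where `A` acts on `Ω`
through the Drinfeld module `φ` with `φ_T = f`, that is, `a • v = φ_a (v)`. -/
def IsLevel (f : Module.End Fq Ω) (N : Fq[X]) (G : Submodule Fq Ω) : Prop :=
  (∀ v ∈ G, aeval f N v = 0) ∧
  ∃ G' : Submodule Fq[X] (Module.AEval' f), (∀ v : Ω, v ∈ G ↔ Module.AEval'.of f v ∈ G') ∧
    Nonempty (G' ≃ₗ[Fq[X]] (Fq[X] ⧸ Ideal.span {N}))

/-- `g(x) = x^(q^m - q^j) - x^(1 - q^j)`. -/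
def gOf (m j : ℕ) (x : Ω) : Ω :=
  x ^ ((Fintype.card Fq : ℤ) ^ m - (Fintype.card Fq : ℤ) ^ j) -
    x ^ (1 - (Fintype.card Fq : ℤ) ^ j)

variable (Ω) in
/-- Geometric points of `X_{m,j}(N)` before passing to isomorphism classes: pairs `(φ, G)` with
`φ_T = g_m τ^m + g_j τ^j + 1` of rank `m`. (Over an algebraically closed field every such `φ` is
isomorphic to a normalized one.) -/
@[ext]
structure Pair (m j : ℕ) (N : Fq[X]) where
  gm : Ω
  gj : Ω
  G : Submodule Fq Ω
  gm_ne : gm ≠ 0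
  level : IsLevel Fq (phiT Fq m j gm gj) N G

variable (Ω) in
/-- Geometric points of `Ẋ_{m,j}(N)`: pairs `(φ, G)` with `φ_T = -τ^m + g_j τ^j + 1`. -/
@[ext]
structure NPair (m j : ℕ) (N : Fq[X]) where
  gj : Ω
  G : Submodule Fq Ω
  level : IsLevel Fq (phiT Fq m j (-1) gj) N G

variable (Ω) in
/-- Geometric points of `Ẍ_{m,j}(N)`: triples `(φ, G, x)` with `φ_T = -τ^m + g_j τ^j + 1` and a
marked point `0 ≠ x ∈ G ∩ Ker φ_T`. -/
@[ext]
structure Triple (m j : ℕ) (N : Fq[X]) where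
  gj : Ω
  G : Submodule Fq Ω
  x : Ω
  level : IsLevel Fq (phiT Fq m j (-1) gj) N G
  x_mem : x ∈ G
  x_ker : phiT Fq m j (-1) gj x = 0
  x_ne : x ≠ 0

variable {Fq} {m j : ℕ} {N : Fq[X]}

/-- `c` is an isomorphism from `(φ, G)` to `(φ', G')`: `c φ_T = φ'_T c` and `c G = G'`. -/
def IsIsom (c : Ω) (P P' : Pair Fq Ω m j N) : Prop :=
  scalar Fq c * phiT Fq m j P.gm P.gj = phiT Fq m j P'.gm P'.gj * scalar Fq c ∧
    P.G.map (scalar Fq c) = P'.G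

theorem scalar_one : scalar Fq (1 : Ω) = 1 := by
  ext v; simp [scalar]

theorem scalar_mul (c d : Ω) : scalar Fq (c * d) = scalar Fq c * scalar Fq d := by
  ext v; simp [scalar]

variable (Fq Ω m j N) in
/-- Equivalence of pairs: existence of an isomorphism. -/
def pairSetoid : Setoid (Pair Fq Ω m j N) where
  r P P' := ∃ c : Ω, c ≠ 0 ∧ IsIsom c P P'
  iseqv :=
    { refl := fun P => ⟨1, one_ne_zero, by simp [scalar_one], by
        rw [scalar_one]; exact Submodule.map_id _⟩
      symm := by
        rintro P P' ⟨c, hc, h1, h2⟩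
        have e1 : scalar Fq c⁻¹ * scalar Fq c = 1 := by
          rw [← scalar_mul, inv_mul_cancel₀ hc, scalar_one]
        have e2 : scalar Fq c * scalar Fq c⁻¹ = 1 := by
          rw [← scalar_mul, mul_inv_cancel₀ hc, scalar_one]
        refine ⟨c⁻¹, inv_ne_zero hc, ?_, ?_⟩
        · calc scalar Fq c⁻¹ * phiT Fq m j P'.gm P'.gj
              = scalar Fq c⁻¹ * (phiT Fq m j P'.gm P'.gj * scalar Fq c) * scalar Fq c⁻¹ := by
                rw [mul_assoc, mul_assoc, e2, mul_one]
            _ = phiT Fq m j P.gm P.gj * scalar Fq c⁻¹ := by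
                rw [← h1, ← mul_assoc (scalar Fq c⁻¹), e1, one_mul]
        · rw [← h2, ← Submodule.map_comp]
          change Submodule.map (scalar Fq c⁻¹ * scalar Fq c) _ = _
          rw [e1]; exact Submodule.map_id _
      trans := by
        rintro P P' P'' ⟨c, hc, h1, h2⟩ ⟨d, hd, h3, h4⟩
        refine ⟨d * c, mul_ne_zero hd hc, ?_, ?_⟩
        · rw [scalar_mul, mul_assoc, h1, ← mul_assoc, h3, mul_assoc]
        · rw [scalar_mul, ← h4, ← h2, ← Submodule.map_comp]; rfl }

variable (Fq Ω m j N) in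
/-- Geometric points of `X_{m,j}(N)`: equivalence classes `[(φ, G)]`. -/
abbrev PairClass := Quotient (pairSetoid Fq Ω m j N)

/-- Every normalized pair is a pair. -/
def NPair.toPair (P : NPair Fq Ω m j N) : Pair Fq Ω m j N :=
  ⟨-1, P.gj, P.G, neg_ne_zero.2 one_ne_zero, P.level⟩

variable (Fq Ω m j N) in
/-- `π₁ : (φ, G, x) ↦ (φ, G)`. -/
def pi1 (P : Triple Fq Ω m j N) : NPair Fq Ω m j N := ⟨P.gj, P.G, P.level⟩

variable (Fq Ω m j N) in
/-- `π₂ : (φ, G) ↦ [(φ, G)]`. -/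
def pi2 (P : NPair Fq Ω m j N) : PairClass Fq Ω m j N := Quotient.mk _ P.toPair

variable (Fq Ω m j N) in
/-- `π₃ = π₂ ∘ π₁ : (φ, G, x) ↦ [(φ, G)]`. -/
def pi3 (P : Triple Fq Ω m j N) : PairClass Fq Ω m j N := pi2 Fq Ω m j N (pi1 Fq Ω m j N P)

theorem tau_pow_apply (i : ℕ) (v : Ω) : (tau Fq ^ i) v = v ^ Fintype.card Fq ^ i := by
  induction i with
  | zero => simp
  | succ i ih =>
    rw [pow_succ', Module.End.mul_apply, ih]
    simp [tau, ← pow_mul, pow_succ]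

theorem phiT_apply (gm gj v : Ω) : phiT Fq m j gm gj v =
    gm * v ^ Fintype.card Fq ^ m + gj * v ^ Fintype.card Fq ^ j + v := by
  simp [phiT, tau_pow_apply]

/-- Level structures are transported by isomorphisms. -/
theorem IsLevel.map {f f' : Module.End Fq Ω} {G : Submodule Fq Ω} (h : IsLevel Fq f N G)
    {c : Ω} (hc : c ≠ 0) (hcf : scalar Fq c * f = f' * scalar Fq c) :
    IsLevel Fq f' N (G.map (scalar Fq c)) := by
  obtain ⟨h1, G', h2, ⟨e⟩⟩ := h
  have hX : ∀ v, scalar Fq c (f v) = f' (scalar Fq c v) := fun v => LinearMap.congr_fun hcf v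
  let s : Ω ≃ₗ[Fq] Ω := LinearEquiv.ofBijective (scalar Fq c)
    ⟨mul_right_injective₀ hc, fun y => ⟨c⁻¹ * y, by simp [scalar, hc]⟩⟩
  let S : Module.AEval' f ≃ₗ[Fq[X]] Module.AEval' f' :=
    LinearEquiv.ofAEval f (s.trans (Module.AEval'.of f')) (fun v => by
      change Module.AEval'.of f' (scalar Fq c (f v)) = X • Module.AEval'.of f' (scalar Fq c v)
      rw [hX, Module.AEval'.X_smul_of])
  have hS : ∀ v, S (Module.AEval'.of f v) = Module.AEval'.of f' (scalar Fq c v) := fun v => rfl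
  have hp : ∀ (p : Fq[X]) (v : Ω), aeval f' p (scalar Fq c v) = scalar Fq c (aeval f p v) := by
    intro p v
    have := S.map_smul p (Module.AEval'.of f v)
    rw [← Module.AEval.of_aeval_smul, hS] at this
    rw [hS, ← Module.AEval.of_aeval_smul] at this
    exact ((Module.AEval'.of f').injective this).symm
  refine ⟨?_, G'.map S.toLinearMap, ?_, ⟨(S.submoduleMap G').symm.trans e⟩⟩
  · rintro _ ⟨v, hv, rfl⟩
    rw [hp, h1 v hv, map_zero]
  · intro v
    constructor
    · rintro ⟨y, hy, rfl⟩
      exact ⟨Module.AEval'.of f y, (h2 y).1 hy, hS y⟩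
    · rintro ⟨y, hy, hyv⟩
      obtain ⟨y, rfl⟩ := (Module.AEval'.of f).surjective y
      exact ⟨y, (h2 y).2 hy, (Module.AEval'.of f').injective hyv⟩

/-- If `φ_T (x) = 0` then `φ = φ^x`. -/
theorem gOf_eq {gj x : Ω} (hx : x ≠ 0) (h : phiT Fq m j (-1) gj x = 0) :
    gOf Fq m j x = gj := by
  have hxj : x ^ Fintype.card Fq ^ j ≠ 0 := pow_ne_zero _ hx
  rw [phiT_apply] at h
  have e : ∀ i : ℕ, x ^ ((Fintype.card Fq : ℤ) ^ i) = x ^ Fintype.card Fq ^ i := fun i => by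
    rw [← zpow_natCast]; push_cast; rfl
  rw [gOf, zpow_sub₀ hx, zpow_sub₀ hx, e, e, zpow_one, ← sub_div, div_eq_iff hxj]
  linear_combination -h

variable {K : Type v} [Field K] [Algebra Fq K] [Algebra K Ω]

/-- For `μ ∈ F_{q^m}^*`, `μ φ^x = φ^{μ x} μ`. -/
theorem scalar_mul_phiT (hK : Module.finrank Fq K = m) (hm : 0 < m) (μ : Kˣ) {gj x : Ω}
    (hx : x ≠ 0) (h : phiT Fq m j (-1) gj x = 0) :
    scalar Fq (algebraMap K Ω μ) * phiT Fq m j (-1) gj =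
      phiT Fq m j (-1) (gOf Fq m j (algebraMap K Ω μ * x)) * scalar Fq (algebraMap K Ω μ) := by
  have hfin : Module.Finite Fq K := Module.finite_of_finrank_pos (hK ▸ hm)
  have hfin' : Finite K := Module.finite_of_finite Fq
  have := Fintype.ofFinite K
  have hμ : (algebraMap K Ω μ) ^ Fintype.card Fq ^ m = algebraMap K Ω μ := by
    rw [← map_pow, ← hK, ← Module.card_eq_pow_finrank, FiniteField.pow_card]
  set c : Ω := algebraMap K Ω μ
  have hc : c ≠ 0 := (_root_.map_ne_zero _).2 μ.ne_zero
  have h0 : phiT Fq m j (-1) (gj * c / c ^ Fintype.card Fq ^ j) (c * x) = 0 := by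
    rw [phiT_apply] at h ⊢
    rw [mul_pow, mul_pow, hμ]
    have : c ^ Fintype.card Fq ^ j ≠ 0 := pow_ne_zero _ hc
    field_simp
    linear_combination c * h
  rw [gOf_eq (mul_ne_zero hc hx) h0]
  ext v
  have : c ^ Fintype.card Fq ^ j ≠ 0 := pow_ne_zero _ hc
  simp only [Module.End.mul_apply, phiT_apply, scalar, LinearMap.mulLeft_apply, mul_pow, hμ]
  field_simp

/-- The scaling by `μ ∈ F_{q^m}^*`: `(φ, G, x) ↦ (φ^{μ x}, μ G, μ x)`. -/
def scale (hK : Module.finrank Fq K = m) (hm : 0 < m) (μ : Kˣ) (P : Triple Fq Ω m j N) :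
    Triple Fq Ω m j N where
  gj := gOf Fq m j (algebraMap K Ω μ * P.x)
  G := P.G.map (scalar Fq (algebraMap K Ω μ))
  x := algebraMap K Ω μ * P.x
  level := P.level.map ((_root_.map_ne_zero _).2 μ.ne_zero) (scalar_mul_phiT hK hm μ P.x_ne P.x_ker)
  x_mem := ⟨P.x, P.x_mem, rfl⟩
  x_ker := by
    have := LinearMap.congr_fun (scalar_mul_phiT (j := j) hK hm μ P.x_ne P.x_ker) P.x
    rw [Module.End.mul_apply, P.x_ker, map_zero] at this
    exact this.symm
  x_ne := mul_ne_zero ((_root_.map_ne_zero _).2 μ.ne_zero) P.x_ne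

variable (Fq Ω K m j N) in
/-- The scalings form an action of `F_{q^m}^*` on the points of `Ẍ_{m,j}(N)`. -/
def scaleHom (hK : Module.finrank Fq K = m) (hm : 0 < m) :
    Kˣ →* Equiv.Perm (Triple Fq Ω m j N) :=
  letI : MulAction Kˣ (Triple Fq Ω m j N) :=
    { smul := scale hK hm
      one_smul := fun P => by
        change scale hK hm 1 P = P
        ext1
        · simp [scale, gOf_eq P.x_ne P.x_ker]
        · simp only [scale, Units.val_one, map_one, scalar_one]; exact Submodule.map_id _
        · simp [scale]
      mul_smul := fun μ ν P => by
        change scale hK hm (μ * ν) P = scale hK hm μ (scale hK hm ν P)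
        ext1
        · simp [scale, mul_assoc]
        · simp only [scale, Units.val_mul, map_mul, scalar_mul]
          exact Submodule.map_comp _ _ _
        · simp [scale, mul_assoc] }
  MulAction.toPermHom Kˣ (Triple Fq Ω m j N)

theorem scaleHom_apply (hK : Module.finrank Fq K = m) (hm : 0 < m) (μ : Kˣ)
    (P : Triple Fq Ω m j N) : scaleHom Fq Ω m j N K hK hm μ P = scale hK hm μ P := rfl

/-! #### Rationality over a subfield `L` with algebraic closure `Ω` -/

variable (L : Type v) [Field L] [Algebra L Ω]

/-- `ξ(G) = G` for all `ξ ∈ Aut(Ω / L)`. -/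
def IsStable (G : Submodule Fq Ω) : Prop := ∀ ξ : Ω ≃ₐ[L] Ω, ξ '' (G : Set Ω) = G

/-- The `L`-points of `Ẍ_{m,j}(N)`: `φ` is defined over `L`, `G` is stable under `Aut(Ω / L)` and
the marked point lies in `L`. -/
def Triple.IsOver (P : Triple Fq Ω m j N) : Prop :=
  P.gj ∈ (algebraMap L Ω).range ∧ IsStable L P.G ∧ P.x ∈ (algebraMap L Ω).range

/-- The `L`-points of `Ẋ_{m,j}(N)`. -/
def NPair.IsOver (P : NPair Fq Ω m j N) : Prop :=
  P.gj ∈ (algebraMap L Ω).range ∧ IsStable L P.G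

/-- The `L`-points of `X_{m,j}(N)`: classes (over `Ω`) of pairs `(φ, G)` such that `φ` is defined
over `L` and `G` is stable under `Aut(Ω / L)`. -/
def PairClass.IsOver (c : PairClass Fq Ω m j N) : Prop :=
  ∃ P : Pair Fq Ω m j N, Quotient.mk _ P = c ∧
    P.gm ∈ (algebraMap L Ω).range ∧ P.gj ∈ (algebraMap L Ω).range ∧ IsStable L P.G

end Points

/-! ### Affine varieties over `K`, through their `Ω`-points and regular functions -/

/-- A set of geometric points with a `K`-algebra of regular `Ω`-valued functions on it. -/
structure KSpace (K : Type v) (Ω : Type w) [Field K] [Field Ω] [Algebra K Ω] where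
  Pt : Type w
  reg : Subalgebra K (Pt → Ω)

section Geometry

variable {K : Type v} {Ω : Type w} [Field K] [Field Ω] [Algebra K Ω]

/-- Evaluation of regular functions at a point. -/
def KSpace.ev (V : KSpace K Ω) (p : V.Pt) : V.reg →ₐ[K] Ω :=
  (Pi.evalAlgHom K (fun _ : V.Pt => Ω) p).comp V.reg.val

/-- `V` is an affine algebraic curve over `K`: its ring of regular functions is finitely generated
of dimension one, and its points are all the `Ω`-points of this ring. -/
structure KSpace.IsAffineCurve (V : KSpace K Ω) : Prop where
  fg : V.reg.FG
  points : Function.Bijective V.ev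
  dim : ringKrullDim V.reg = 1

/-- `a : Y → X` is a morphism over `K`: it pulls back regular functions to regular functions. -/
def IsMorphism {Y X : KSpace K Ω} (a : Y.Pt → X.Pt) : Prop := ∀ h ∈ X.reg, h ∘ a ∈ Y.reg

/-- The morphism `a : Y → X` is an (unramified) Galois covering with group `Γ`, acting on `Y`
through `ρ`: the group acts by automorphisms of `Y`, it acts simply transitively on every fibre
of the surjective morphism `a`, and the regular functions of `X` are the `Γ`-invariant regular
functions of `Y`. -/
structure IsGaloisCovering {Y X : KSpace K Ω} (a : Y.Pt → X.Pt) {Γ : Type*} [Group Γ]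
    (ρ : Γ →* Equiv.Perm Y.Pt) : Prop where
  morphism : IsMorphism a
  automorphism : ∀ σ, IsMorphism (Y := Y) (X := Y) (ρ σ)
  surjective : Function.Surjective a
  fibre : ∀ y y', a y = a y' ↔ ∃! σ, ρ σ y = y'
  invariant : ∀ f ∈ Y.reg, (∀ σ, f ∘ ρ σ = f) → ∃ h ∈ X.reg, f = h ∘ a

/-- Whenever `Y` and `X` have function fields `E` and `F` (that is, whenever `Y` and `X` are
irreducible), the extension `E / F` given by the pullback along `a` is Galois with Galois group
isomorphic to `Γ`. -/
def IsGaloisOnFunctionFields {Y X : KSpace K Ω} (a : Y.Pt → X.Pt) (Γ : Type*) [Group Γ] : Prop :=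
  ∀ (F E : Type w) [Field F] [Field E] [Algebra X.reg F] [Algebra Y.reg E]
    [IsFractionRing X.reg F] [IsFractionRing Y.reg E] [Algebra F E],
    (∀ (h : X.reg) (f : Y.reg), (f : Y.Pt → Ω) = (h : X.Pt → Ω) ∘ a →
      algebraMap F E (algebraMap X.reg F h) = algebraMap Y.reg E f) →
    IsGalois F E ∧ Nonempty ((E ≃ₐ[F] E) ≃* Γ)

/-- The coordinates of a finite set `S ⊆ Ω`: the coefficients of `∏_{v ∈ S} (X - v)`. -/
def coord (S : Set Ω) (i : ℕ) : Ω := (∏ᶠ v ∈ S, (X - C v : Polynomial Ω)).coeff i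

end Geometry

/-! ### The three Drinfeld modular curves -/

section Curves

variable (Fq : Type u) [Field Fq] [Fintype Fq] (K : Type v) [Field K]
  (Ω : Type w) [Field Ω] [Algebra Fq Ω] [Algebra K Ω] (m j : ℕ) (N : Fq[X])

/-- `Ẍ_{m,j}(N)`: its regular functions are the polynomials over `K` in the coordinates
`g_j`, the coefficients of `∏_{v ∈ G} (X - v)`, and `x`. -/
def XDD : KSpace K Ω where
  Pt := Triple Fq Ω m j N
  reg := Algebra.adjoin K ({fun P => P.gj, fun P => P.x} ∪
    Set.range (fun (i : ℕ) (P : Triple Fq Ω m j N) => coord (P.G : Set Ω) i))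

/-- `Ẋ_{m,j}(N)`: its regular functions are the polynomials over `K` in the coordinates
`g_j` and the coefficients of `∏_{v ∈ G} (X - v)`. -/
def XD : KSpace K Ω where
  Pt := NPair Fq Ω m j N
  reg := Algebra.adjoin K ({fun P => P.gj} ∪
    Set.range (fun (i : ℕ) (P : NPair Fq Ω m j N) => coord (P.G : Set Ω) i))

/-- The variety of all pairs `(φ, G)`: its regular functions are the polynomials over `K` in the
coordinates `g_m`, `g_m⁻¹`, `g_j` and the coefficients of `∏_{v ∈ G} (X - v)`. -/
def pairSpace : KSpace K Ω where
  Pt := Pair Fq Ω m j N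
  reg := Algebra.adjoin K ({fun P => P.gm, fun P => P.gm⁻¹, fun P => P.gj} ∪
    Set.range (fun (i : ℕ) (P : Pair Fq Ω m j N) => coord (P.G : Set Ω) i))

/-- `X_{m,j}(N)`, the quotient of the variety of pairs by isomorphism: a function of the
equivalence class `[(φ, G)]` is regular if it is a regular function of the pair `(φ, G)`. -/
def X0 : KSpace K Ω where
  Pt := PairClass Fq Ω m j N
  reg := (pairSpace Fq K Ω m j N).reg.comap
    (AlgHom.pi (R := K) (A := fun _ : Pair Fq Ω m j N => Ω) (fun P => Pi.evalAlgHom K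
      (fun _ : PairClass Fq Ω m j N => Ω) (Quotient.mk _ P)))

end Curves

end DrinfeldCurve

end

open DrinfeldCurve

/-! A level structure G is a cyclic module generated by some z with T^n z = 0 and T^(n-1) z ≠ 0. Its
socle G ∩ Ker φ_T is the line spanned over `Fq` by T^(n-1) z, so the marked points on (φ, G) form a
single free orbit of `Fqˣ`: this gives the fibres of `pi1`. An isomorphism c between normalized
modules satisfies c^(q^m) = c, hence c lies in `K`; correcting it by an element of `Fqˣ` makes it
match the marked points. This gives the fibres of `pi3`.

Affineness. Choose a generator ζ(P) at every point P, with no regularity required. The functions T^k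
ζ are integral over any algebra of functions containing g_j, by descending induction on k, and the
coefficients of ∏(Z - v) are polynomials in them. A character of the ring of regular functions
extends to the integral closure and carries ζ to a generator over Ω, so it is evaluation at a point
(`exists_generator_of_algHom`). Integrality over K[g_j] also gives dimension one. The curve X
inherits these properties from Ẍ by `IsGaloisCovering.isAffineCurve`.

Invariants of `Fqˣ`. A regular function on Ẍ is a polynomial in x over the functions of Ẋ, and
averaging leaves only powers of x^(q-1). That x^(q-1) is regular on Ẋ (`exists_socleFunction`) is
the delicate point: the polynomials of the submodules G[T^k] are obtained by successive division
with remainder, whose leading coefficients vanish nowhere and so are units by the Nullstellensatz.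

Invariants of `Kˣ`. Regular functions of pairs are sums of homogeneous ones. Averaging over `Kˣ`
kills every weight not divisible by q^m - 1, and the other weights are brought to zero by powers of
-g_m, which equals 1 on normalized pairs (`exists_of_invariant`).

The pair (x⁻¹ φ x, x⁻¹ G) depends only on the class of (φ, G), and its coordinates are regular on X.
Hence regular functions separate the points of X and detect which of them are L-rational. -/

noncomputable section

namespace DrinfeldCurve

/-! ### Integral extensions, the Nullstellensatz, and Galois coverings in general -/

section Generic

/-- Incomparability makes contraction of primes strictly monotone, which bounds the dimension of S;
lying over and going up lift chains, which bounds that of R. -/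
theorem ringKrullDim_eq_of_isIntegral {R S : Type*} [CommRing R] [CommRing S] [Algebra R S]
    [Algebra.IsIntegral R S] (hinj : Function.Injective (algebraMap R S)) :
    ringKrullDim S = ringKrullDim R := by
  apply le_antisymm
  · refine Order.krullDim_le_of_strictMono (PrimeSpectrum.comap (algebraMap R S)) ?_
    intro I J hIJ
    exact Ideal.IsIntegral.comap_lt_comap hIJ
  · rw [ringKrullDim, ringKrullDim, Order.krullDim]
    refine iSup_le fun l => ?_
    obtain ⟨Q, -, hQ, hQ'⟩ := Ideal.exists_ideal_over_prime_of_isIntegral (S := S)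
      l.head.asIdeal ⊥
      (by rw [← RingHom.ker_eq_comap_bot, (RingHom.injective_iff_ker_eq_bot _).1 hinj]; exact bot_le)
    have : Q.LiesOver l.head.asIdeal := ⟨hQ'.symm⟩
    obtain ⟨L', hL, -⟩ := Ideal.exists_ltSeries_of_hasGoingUp (S := S) l Q
    rw [← hL]
    exact le_iSup (fun p : LTSeries (PrimeSpectrum S) => ((p.length : ℕ) : WithBot ℕ∞)) L'

/-- The kernel of χ has a prime Q above it, and S/Q is an algebraic domain over R/ker χ, so it maps
to Ω. This is how geometric points are lifted along integral maps. -/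
theorem exists_ringHom_extension {R S Ω : Type*} [CommRing R] [CommRing S] [Field Ω]
    [IsAlgClosed Ω] [Algebra R S] [Algebra.IsIntegral R S]
    (hinj : Function.Injective (algebraMap R S)) (χ : R →+* Ω) :
    ∃ χ' : S →+* Ω, ∀ r, χ' (algebraMap R S r) = χ r := by
  have hp : (RingHom.ker χ).IsPrime := RingHom.ker_isPrime χ
  obtain ⟨Q, -, hQ, hQ'⟩ := Ideal.exists_ideal_over_prime_of_isIntegral (S := S)
    (RingHom.ker χ) ⊥
    (by rw [← RingHom.ker_eq_comap_bot, (RingHom.injective_iff_ker_eq_bot _).1 hinj]; exact bot_le)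
  have : Q.LiesOver (RingHom.ker χ) := ⟨hQ'.symm⟩
  let : Algebra (R ⧸ RingHom.ker χ) Ω := (RingHom.kerLift χ).toAlgebra
  have hi : Function.Injective (algebraMap (R ⧸ RingHom.ker χ) Ω) := RingHom.kerLift_injective χ
  have : Module.IsTorsionFree (R ⧸ RingHom.ker χ) Ω := by
    have hdR : IsDomain (R ⧸ RingHom.ker χ) := Ideal.Quotient.isDomain _
    exact Module.isTorsionFree_iff_faithfulSMul.2 ((faithfulSMul_iff_algebraMap_injective _ _).2 hi)
  have : Algebra.IsIntegral (R ⧸ RingHom.ker χ) (S ⧸ Q) := inferInstance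
  have hfaith : FaithfulSMul (R ⧸ RingHom.ker χ) (S ⧸ Q) := inferInstance
  have hdR : IsDomain (R ⧸ RingHom.ker χ) := Ideal.Quotient.isDomain _
  have hdS : IsDomain (S ⧸ Q) := Ideal.Quotient.isDomain _
  have : Module.IsTorsionFree (R ⧸ RingHom.ker χ) (S ⧸ Q) :=
    Module.isTorsionFree_iff_faithfulSMul.2 hfaith
  let g : (S ⧸ Q) →ₐ[R ⧸ RingHom.ker χ] Ω := IsAlgClosed.lift
  refine ⟨g.toRingHom.comp (Ideal.Quotient.mk Q), fun r => ?_⟩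
  exact g.commutes (Ideal.Quotient.mk _ r)

/-- A non-unit lies in a maximal ideal, whose residue field is finite over K and therefore embeds in
Ω. -/
theorem isUnit_of_forall_algHom_ne_zero {K R Ω : Type*} [Field K] [CommRing R] [Algebra K R]
    [Field Ω] [IsAlgClosed Ω] [Algebra K Ω] [Algebra.FiniteType K R] (r : R)
    (h : ∀ χ : R →ₐ[K] Ω, χ r ≠ 0) : IsUnit r := by
  by_contra hr
  obtain ⟨M, hM, hrM⟩ := exists_max_ideal_of_mem_nonunits hr
  let := Ideal.Quotient.field M
  have : Module.Finite K (R ⧸ M) := finite_of_finite_type_of_isJacobsonRing K (R ⧸ M)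
  let g : (R ⧸ M) →ₐ[K] Ω := IsAlgClosed.lift
  refine h (g.comp (Ideal.Quotient.mkₐ K M)) ?_
  simp [Ideal.Quotient.eq_zero_iff_mem.2 hrM]

theorem mem_range_of_isSeparable_of_fixed {L Ω : Type*} [Field L] [Field Ω] [Algebra L Ω]
    [Normal L Ω] {x : Ω} (hs : IsSeparable L x) (h : ∀ ξ : Ω ≃ₐ[L] Ω, ξ x = x) :
    x ∈ (algebraMap L Ω).range := by
  by_contra hx
  have hx' : x ∉ (⊥ : Subalgebra L Ω) := fun h' => hx (by
    obtain ⟨y, hy⟩ := Algebra.mem_bot.1 h'; exact ⟨y, hy⟩)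
  obtain ⟨y, hy, hc⟩ := (notMem_iff_exists_ne_and_isConjRoot hs (Normal.splits inferInstance x)).1 hx'
  obtain ⟨σ, hσ⟩ := isConjRoot_iff_exists_algEquiv.1 hc.symm
  exact hy ((h σ).symm.trans hσ)

section Covering

variable {K : Type v} {Ω : Type w} [Field K] [Field Ω] [Algebra K Ω] {Y X : KSpace K Ω}
  {a : Y.Pt → X.Pt} {Γ : Type*} [Group Γ] {ρ : Γ →* Equiv.Perm Y.Pt}

/-- The pullback of regular functions along a morphism. -/
def IsMorphism.pullback (h : IsMorphism a) : X.reg →ₐ[K] Y.reg where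
  toFun f := ⟨f.1 ∘ a, h _ f.2⟩
  map_one' := rfl
  map_zero' := rfl
  map_add' _ _ := rfl
  map_mul' _ _ := rfl
  commutes' _ := rfl

theorem IsMorphism.pullback_injective (h : IsMorphism a) (ha : Function.Surjective a) :
    Function.Injective h.pullback := fun _ _ hfg =>
  Subtype.ext (ha.injective_comp_right (congrArg Subtype.val hfg))

/-- The action of the group of a Galois covering on the regular functions. -/
@[reducible]
def IsGaloisCovering.mulSemiringAction (h : IsGaloisCovering a ρ) : MulSemiringAction Γ Y.reg where
  -- The inverse turns precomposition, which reverses products, into a left action.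
  smul σ f := ⟨f.1 ∘ ρ σ⁻¹, h.automorphism _ _ f.2⟩
  one_smul f := by
    apply Subtype.ext
    change f.1 ∘ ρ (1 : Γ)⁻¹ = f.1
    simp
  mul_smul σ τ f := by
    apply Subtype.ext
    change f.1 ∘ ρ (σ * τ)⁻¹ = (f.1 ∘ ρ τ⁻¹) ∘ ρ σ⁻¹
    rw [mul_inv_rev, map_mul]
    rfl
  smul_zero _ := rfl
  smul_add _ _ _ := rfl
  smul_one _ := rfl
  smul_mul _ _ _ := rfl

theorem IsGaloisCovering.isInvariant (h : IsGaloisCovering a ρ) :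
    let := h.mulSemiringAction
    let := h.morphism.pullback.toRingHom.toAlgebra
    Algebra.IsInvariant X.reg Y.reg Γ := by
  intro act alg
  refine ⟨fun f hf => ?_⟩
  obtain ⟨g, hg, hfg⟩ := h.invariant f.1 f.2 fun σ => by
    have e : (σ⁻¹ • f).1 = f.1 ∘ ρ σ⁻¹⁻¹ := rfl
    rw [hf σ⁻¹, inv_inv] at e
    exact e.symm
  exact ⟨⟨g, hg⟩, Subtype.ext hfg.symm⟩

/-- The fibre axiom at the pair (y, y) says that the stabilizer of y is trivial; hence σ is the only
element carrying y to `ρ σ y`, and the axiom applies backwards. -/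
theorem IsGaloisCovering.apply_eq (h : IsGaloisCovering a ρ) (σ : Γ) (y : Y.Pt) :
    a (ρ σ y) = a y := by
  refine ((h.fibre y (ρ σ y)).2 ?_).symm
  obtain ⟨σ', h1, h2⟩ := (h.fibre y y).1 rfl
  refine ⟨σ, rfl, fun τ hτ => ?_⟩
  have e1 := h2 1 (by simp)
  have e2 := h2 (σ⁻¹ * τ) (by
    change ρ (σ⁻¹ * τ) y = y
    rw [map_mul, Equiv.Perm.mul_apply, hτ, ← Equiv.Perm.mul_apply, ← map_mul]; simp)
  rw [← e1] at e2
  exact (inv_mul_eq_one.1 e2).symm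

theorem IsGaloisCovering.smulCommClass (h : IsGaloisCovering a ρ) :
    let := h.mulSemiringAction
    let := h.morphism.pullback.toRingHom.toAlgebra
    SMulCommClass Γ X.reg Y.reg := by
  intro act alg
  refine ⟨fun σ f g => ?_⟩
  apply Subtype.ext
  funext y
  rw [Algebra.smul_def, Algebra.smul_def]
  change f.1 (a (ρ σ⁻¹ y)) * g.1 (ρ σ⁻¹ y) = f.1 (a y) * g.1 (ρ σ⁻¹ y)
  rw [h.apply_eq]

theorem IsGaloisCovering.isIntegral [Finite Γ] (h : IsGaloisCovering a ρ) :
    let := h.morphism.pullback.toRingHom.toAlgebra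
    Algebra.IsIntegral X.reg Y.reg := by
  intro alg
  let := h.mulSemiringAction
  have := h.isInvariant
  exact Algebra.IsInvariant.isIntegral X.reg Y.reg Γ

/-- The base of a finite Galois covering by an affine curve is an affine curve as soon as its
regular functions separate its points. -/
theorem IsGaloisCovering.isAffineCurve [Finite Γ] [IsAlgClosed Ω] (h : IsGaloisCovering a ρ)
    (hY : Y.IsAffineCurve) (hX : Function.Injective X.ev) : X.IsAffineCurve := by
  let := h.morphism.pullback.toRingHom.toAlgebra
  have hint : Algebra.IsIntegral X.reg Y.reg := h.isIntegral
  have hinj : Function.Injective (algebraMap X.reg Y.reg) :=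
    h.morphism.pullback_injective h.surjective
  have : IsScalarTower K X.reg Y.reg := IsScalarTower.of_algebraMap_eq fun _ => rfl
  have hft : Algebra.FiniteType K Y.reg := Y.reg.fg_iff_finiteType.1 hY.fg
  have : Algebra.FiniteType X.reg Y.reg := Algebra.FiniteType.of_restrictScalars_finiteType K _ _
  have hfin : Module.Finite X.reg Y.reg := Algebra.IsIntegral.finite
  refine ⟨?_, ⟨hX, fun χ => ?_⟩, ?_⟩
  -- The Artin–Tate lemma: `Y.reg` is finite over `X.reg` and finitely generated over K.
  · exact X.reg.fg_iff_finiteType.2 ⟨fg_of_fg_of_fg K X.reg Y.reg hft.out hfin.fg_top hinj⟩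
  · obtain ⟨χ', hχ'⟩ := exists_ringHom_extension hinj χ.toRingHom
    have hcomm : ∀ k, χ' (algebraMap K Y.reg k) = algebraMap K Ω k := fun k => by
      rw [IsScalarTower.algebraMap_apply K X.reg Y.reg, hχ']
      exact χ.commutes k
    obtain ⟨y, hy⟩ := hY.points.2 { χ' with commutes' := hcomm }
    refine ⟨a y, AlgHom.ext fun f => ?_⟩
    have := DFunLike.congr_fun hy (algebraMap X.reg Y.reg f)
    exact this.trans (hχ' f)
  · rw [← ringKrullDim_eq_of_isIntegral hinj, hY.dim]

/-- A Galois covering whose source has enough regular functions to separate its points induces a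
Galois extension of function fields. -/
theorem IsGaloisCovering.isGaloisOnFunctionFields [Finite Γ] (h : IsGaloisCovering a ρ)
    (hY : Function.Injective Y.ev) : IsGaloisOnFunctionFields (Y := Y) (X := X) a Γ := by
  intro F E _ _ _ _ _ _ _ hcomp
  have hdY : IsDomain Y.reg := (IsFractionRing.injective Y.reg E).isDomain _
  let := h.mulSemiringAction
  let := h.morphism.pullback.toRingHom.toAlgebra
  let : Algebra X.reg E := ((algebraMap Y.reg E).comp (algebraMap X.reg Y.reg)).toAlgebra
  have : IsScalarTower X.reg Y.reg E := IsScalarTower.of_algebraMap_eq fun f => rfl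
  have : IsScalarTower X.reg F E := IsScalarTower.of_algebraMap_eq fun f =>
    (hcomp f (algebraMap X.reg Y.reg f) rfl).symm
  have : IsGaloisGroup Γ X.reg Y.reg :=
    -- Elements acting equally on functions send y to the same point, since functions separate
    -- points; freeness of the action then identifies them.
    { faithful := ⟨fun {σ τ} hst => by
        have hne : Nonempty Y.Pt := by
          by_contra hne
          rw [not_nonempty_iff] at hne
          exact zero_ne_one (α := Y.reg) (Subtype.ext (Subsingleton.elim _ _))
        obtain ⟨y⟩ := hne
        have hy : ρ σ⁻¹ y = ρ τ⁻¹ y := hY (AlgHom.ext fun f =>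
          congrFun (congrArg Subtype.val (hst f)) y)
        obtain ⟨s, -, hs⟩ := (h.fibre y (ρ σ⁻¹ y)).1 (h.apply_eq _ _).symm
        exact inv_injective ((hs _ rfl).trans (hs _ hy.symm).symm)⟩
      commutes := h.smulCommClass
      isInvariant := h.isInvariant }
  let := IsFractionRing.mulSemiringAction Γ Y.reg E
  have hG : IsGaloisGroup Γ F E := IsGaloisGroup.to_isFractionRing Γ X.reg Y.reg F E
  exact ⟨hG.isGalois, ⟨(IsGaloisGroup.mulEquivAlgEquiv Γ F E).symm⟩⟩

end Covering

end Generic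

/-! ### Cyclic modules over `Fq[T]` annihilated by a power of T -/

section LinearAlgebra

variable {Fq : Type u} [Field Fq] {Ω : Type w} [Field Ω] [Algebra Fq Ω]
  {f : Module.End Fq Ω} {s : ℕ} {z : Ω}

/-- `z` is annihilated by `T ^ (s + 1)` but not by `T ^ s`, where `T` acts through `f`. -/
def IsGenerator (f : Module.End Fq Ω) (s : ℕ) (z : Ω) : Prop :=
  (f ^ (s + 1)) z = 0 ∧ (f ^ s) z ≠ 0

/-- The `Fq[T]`-submodule generated by `z`, where `T` acts through `f`. -/
def orbitSpan (f : Module.End Fq Ω) (z : Ω) : Submodule Fq Ω :=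
  LinearMap.range ((LinearMap.applyₗ z) ∘ₗ (aeval f : Fq[X] →ₐ[Fq] _).toLinearMap)

theorem mem_orbitSpan {v : Ω} : v ∈ orbitSpan f z ↔ ∃ p : Fq[X], aeval f p z = v := by
  simp [orbitSpan]

theorem pow_apply_mem_orbitSpan (i : ℕ) : (f ^ i) z ∈ orbitSpan f z :=
  mem_orbitSpan.2 ⟨X ^ i, by simp⟩

theorem aeval_X_pow_mul_apply (k : ℕ) (p : Fq[X]) (v : Ω) :
    aeval f (X ^ k * p) v = (f ^ k) (aeval f p v) := by
  simp [Module.End.mul_apply]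

theorem aeval_mul_X_pow_apply (k : ℕ) (p : Fq[X]) (v : Ω) :
    aeval f (X ^ k * p) v = aeval f p ((f ^ k) v) := by
  rw [mul_comm]; simp [Module.End.mul_apply]

/-- The annihilator of z is generated by T^(s+1). The powers of T dividing p are found one at a
time. -/
theorem IsGenerator.aeval_eq_zero_iff (hz : IsGenerator f s z) (p : Fq[X]) :
    aeval f p z = 0 ↔ X ^ (s + 1) ∣ p := by
  constructor
  · intro hp
    suffices h : ∀ k ≤ s + 1, X ^ k ∣ p from h _ le_rfl
    intro k
    induction k with
    | zero => intro _; simp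
    | succ k ih =>
      intro hk
      obtain ⟨r, rfl⟩ := ih (by omega)
      rw [pow_succ]
      refine mul_dvd_mul_left _ ?_
      rw [X_dvd_iff]
      -- Multiplying by T^(s-k) leaves T^s r(T) z = r(0) T^s z, which forces r(0) = 0.
      have h1 : aeval f (X ^ (s - k) * (X ^ k * r)) z = 0 := by
        rw [aeval_X_pow_mul_apply, hp, map_zero]
      rw [← mul_assoc, ← pow_add, Nat.sub_add_cancel (by omega : k ≤ s)] at h1
      rw [← divX_mul_X_add r, mul_add, mul_comm r.divX, ← mul_assoc, ← pow_succ, map_add,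
        LinearMap.add_apply, aeval_mul_X_pow_apply, hz.1, map_zero, zero_add,
        aeval_X_pow_mul_apply] at h1
      simpa [hz.2] using h1
  · rintro ⟨r, rfl⟩
    rw [aeval_mul_X_pow_apply, hz.1, map_zero]

/-- The generator is the element corresponding to 1 in A/(T^(s+1)); conversely the quotient by the
annihilator of z is the orbit. From here on level structures are handled through generators. -/
theorem isLevel_X_pow_iff {G : Submodule Fq Ω} :
    IsLevel Fq f (X ^ (s + 1)) G ↔ ∃ z, IsGenerator f s z ∧ G = orbitSpan f z := by
  constructor
  · rintro ⟨h1, G', h2, ⟨e⟩⟩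
    obtain ⟨z, hz⟩ := (Module.AEval'.of f).surjective (e.symm (Ideal.Quotient.mk _ 1) : G')
    have key : ∀ p : Fq[X], Module.AEval'.of f (aeval f p z) =
        (e.symm (Ideal.Quotient.mk _ p) : G') := by
      intro p
      have := Module.AEval.of_aeval_smul (R := Fq) (M := Ω) (a := f) p z
      change Module.AEval.of Fq Ω f (aeval f p • z) = _
      rw [this]
      change p • Module.AEval'.of f z = _
      rw [hz, ← Submodule.coe_smul, ← map_smul]
      congr 3
      rw [← Ideal.Quotient.mk_eq_mk, ← Ideal.Quotient.mk_eq_mk, ← Submodule.Quotient.mk_smul]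
      simp
    have hzero : ∀ p : Fq[X], aeval f p z = 0 ↔ X ^ (s + 1) ∣ p := by
      intro p
      rw [← (Module.AEval'.of f).map_eq_zero_iff, key, Submodule.coe_eq_zero,
        e.symm.map_eq_zero_iff, Ideal.Quotient.eq_zero_iff_mem, Ideal.mem_span_singleton]
    refine ⟨z, ⟨?_, ?_⟩, ?_⟩
    · simpa using (hzero (X ^ (s + 1))).2 dvd_rfl
    · intro h
      have := (hzero (X ^ s)).1 (by simpa using h)
      rw [pow_dvd_pow_iff X_ne_zero not_isUnit_X] at this
      omega
    · ext v
      rw [mem_orbitSpan, h2]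
      constructor
      · intro hv
        obtain ⟨p, hp⟩ := Ideal.Quotient.mk_surjective (e ⟨_, hv⟩)
        refine ⟨p, (Module.AEval'.of f).injective ?_⟩
        rw [key, hp, e.symm_apply_apply]
      · rintro ⟨p, rfl⟩
        rw [key]
        exact Subtype.prop _
  · rintro ⟨z, hz, rfl⟩
    let t : Fq[X] →ₗ[Fq[X]] Module.AEval' f :=
      LinearMap.toSpanSingleton Fq[X] (Module.AEval' f) (Module.AEval'.of f z)
    have ht : ∀ p, t p = Module.AEval'.of f (aeval f p z) := fun p =>
      (Module.AEval.of_aeval_smul (R := Fq) (M := Ω) (a := f) p z).symm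
    have hker : LinearMap.ker t = Ideal.span {X ^ (s + 1)} := by
      ext p
      rw [LinearMap.mem_ker, ht, (Module.AEval'.of f).map_eq_zero_iff, hz.aeval_eq_zero_iff,
        Ideal.mem_span_singleton]
    refine ⟨?_, LinearMap.range t, ?_,
      ⟨t.quotKerEquivRange.symm.trans (Submodule.quotEquivOfEq _ _ hker)⟩⟩
    · intro v hv
      obtain ⟨p, rfl⟩ := mem_orbitSpan.1 hv
      rw [← Module.End.mul_apply, ← map_mul, hz.aeval_eq_zero_iff]
      exact dvd_mul_right _ _
    · intro v
      rw [mem_orbitSpan]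
      constructor
      · rintro ⟨p, rfl⟩
        exact ⟨p, ht p⟩
      · rintro ⟨p, hp⟩
        exact ⟨p, (Module.AEval'.of f).injective ((ht p).symm.trans hp)⟩

/-- The `Fq`-linear combination of `z, f z, …, f ^ s z` with coefficients `a`. -/
def combo (f : Module.End Fq Ω) (s : ℕ) (z : Ω) (a : Fin (s + 1) → Fq) : Ω :=
  ∑ i, a i • (f ^ (i : ℕ)) z

theorem combo_eq_aeval (a : Fin (s + 1) → Fq) :
    combo f s z a = aeval f (∑ i, C (a i) * X ^ (i : ℕ)) z := by
  simp [combo, Module.algebraMap_end_apply]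

theorem coeff_sum_fin (a : Fin (s + 1) → Fq) (k : Fin (s + 1)) :
    (∑ i, C (a i) * X ^ (i : ℕ) : Fq[X]).coeff k = a k := by
  simp [coeff_X_pow, Fin.val_inj, finsetSum_coeff]

theorem IsGenerator.combo_injective (hz : IsGenerator f s z) :
    Function.Injective (combo f s z) := by
  intro a b hab
  rw [combo_eq_aeval, combo_eq_aeval, ← sub_eq_zero, ← LinearMap.sub_apply, ← map_sub,
    hz.aeval_eq_zero_iff, X_pow_dvd_iff] at hab
  funext k
  have := hab k k.2
  rwa [coeff_sub, coeff_sum_fin, coeff_sum_fin, sub_eq_zero] at this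

theorem IsGenerator.range_combo (hz : IsGenerator f s z) :
    Set.range (combo f s z) = (orbitSpan f z : Set Ω) := by
  ext v
  rw [SetLike.mem_coe, mem_orbitSpan]
  constructor
  · rintro ⟨a, rfl⟩
    exact ⟨_, (combo_eq_aeval a).symm⟩
  · rintro ⟨p, rfl⟩
    refine ⟨fun i => p.coeff i, ?_⟩
    rw [combo_eq_aeval, ← sub_eq_zero, ← LinearMap.sub_apply, ← map_sub,
      hz.aeval_eq_zero_iff, X_pow_dvd_iff]
    intro d hd
    rw [coeff_sub, sub_eq_zero]
    exact coeff_sum_fin (fun i : Fin (s + 1) => p.coeff i) ⟨d, hd⟩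

theorem IsGenerator.finite [Finite Fq] (hz : IsGenerator f s z) :
    (orbitSpan f z : Set Ω).Finite := by
  rw [← hz.range_combo]; exact Set.finite_range _

theorem IsGenerator.ncard [Fintype Fq] (hz : IsGenerator f s z) :
    (orbitSpan f z : Set Ω).ncard = Fintype.card Fq ^ (s + 1) := by
  rw [← hz.range_combo, ← Set.image_univ, Set.ncard_image_of_injective _ hz.combo_injective,
    Set.ncard_univ, Nat.card_eq_fintype_card]
  simp

theorem IsGenerator.pow_apply (hz : IsGenerator f s z) {i : ℕ} (hi : i ≤ s) :
    IsGenerator f i ((f ^ (s - i)) z) := by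
  constructor
  · rw [← Module.End.mul_apply, ← pow_add, show i + 1 + (s - i) = s + 1 by omega, hz.1]
  · rw [← Module.End.mul_apply, ← pow_add, show i + (s - i) = s by omega]
    exact hz.2

/-- T^(i+1) kills p(T) z exactly when T^(s-i) divides p. -/
theorem IsGenerator.orbitSpan_inf_ker (hz : IsGenerator f s z) {i : ℕ} (hi : i ≤ s) :
    orbitSpan f z ⊓ LinearMap.ker (f ^ (i + 1)) = orbitSpan f ((f ^ (s - i)) z) := by
  ext v
  rw [Submodule.mem_inf, mem_orbitSpan, mem_orbitSpan, LinearMap.mem_ker]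
  constructor
  · rintro ⟨⟨p, rfl⟩, h⟩
    rw [← aeval_X_pow_mul_apply, hz.aeval_eq_zero_iff, show s + 1 = (i + 1) + (s - i) by omega,
      pow_add, mul_dvd_mul_iff_left (pow_ne_zero _ X_ne_zero)] at h
    obtain ⟨r, rfl⟩ := h
    exact ⟨r, (aeval_mul_X_pow_apply _ _ _).symm⟩
  · rintro ⟨p, rfl⟩
    refine ⟨⟨X ^ (s - i) * p, aeval_mul_X_pow_apply _ _ _⟩, ?_⟩
    rw [← aeval_mul_X_pow_apply, ← aeval_X_pow_mul_apply, hz.aeval_eq_zero_iff, ← mul_assoc,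
      ← pow_add, show i + 1 + (s - i) = s + 1 by omega]
    exact dvd_mul_right _ _

/-- The socle is a line over `Fq`; two marked points of the same G therefore differ by a scalar. -/
theorem IsGenerator.exists_smul_of_apply_eq_zero (hz : IsGenerator f s z) {v : Ω}
    (hv : v ∈ orbitSpan f z) (h : f v = 0) : ∃ c : Fq, v = c • (f ^ s) z := by
  have : v ∈ orbitSpan f z ⊓ LinearMap.ker (f ^ (0 + 1)) := ⟨hv, by simpa using h⟩
  rw [hz.orbitSpan_inf_ker (Nat.zero_le s), ← SetLike.mem_coe,
    ← (hz.pow_apply (Nat.zero_le s)).range_combo] at this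
  obtain ⟨a, rfl⟩ := this
  exact ⟨a 0, by simp [combo]⟩

end LinearAlgebra

/-! ### The polynomial of a finite set or of a finite `Fq`-subspace -/

section LevelPoly

variable {Ω : Type w} [Field Ω]

/-- The polynomial `∏_{v ∈ S} (X - v)`. -/
def levelPoly (S : Set Ω) : Polynomial Ω := ∏ᶠ v ∈ S, (X - C v)

theorem coord_eq_coeff (S : Set Ω) (i : ℕ) : coord S i = (levelPoly S).coeff i := rfl

theorem levelPoly_eq_prod {S : Set Ω} (hS : S.Finite) :
    levelPoly S = ∏ v ∈ hS.toFinset, (X - C v) :=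
  finprod_mem_eq_finite_toFinset_prod _ hS

theorem levelPoly_monic (S : Set Ω) : (levelPoly S).Monic :=
  finprod_mem_induction Monic monic_one (fun _ _ => Monic.mul) (fun v _ => monic_X_sub_C v)

theorem natDegree_levelPoly {S : Set Ω} (hS : S.Finite) :
    (levelPoly S).natDegree = S.ncard := by
  rw [levelPoly_eq_prod hS, natDegree_prod_of_monic _ _ fun v _ => monic_X_sub_C v,
    Set.ncard_eq_toFinset_card S hS]
  simp

theorem eval_levelPoly {S : Set Ω} (hS : S.Finite) (w : Ω) :
    (levelPoly S).eval w = ∏ v ∈ hS.toFinset, (w - v) := by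
  rw [levelPoly_eq_prod hS, eval_prod]; simp

theorem eval_levelPoly_eq_zero_iff {S : Set Ω} (hS : S.Finite) {w : Ω} :
    (levelPoly S).eval w = 0 ↔ w ∈ S := by
  rw [eval_levelPoly hS, Finset.prod_eq_zero_iff]
  constructor
  · rintro ⟨v, hv, h⟩
    rw [sub_eq_zero.1 h]; exact hS.mem_toFinset.1 hv
  · intro h; exact ⟨w, hS.mem_toFinset.2 h, sub_self w⟩

theorem levelPoly_dvd {S : Set Ω} (hS : S.Finite) {p : Polynomial Ω} (h : ∀ v ∈ S, p.eval v = 0) :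
    levelPoly S ∣ p := by
  rw [levelPoly_eq_prod hS]
  refine Finset.prod_dvd_of_coprime (fun v _ w _ hvw => ?_) fun v hv => ?_
  · exact pairwise_coprime_X_sub_C Function.injective_id hvw
  · exact dvd_iff_isRoot.2 (h v (hS.mem_toFinset.1 hv))

theorem levelPoly_injOn {S S' : Set Ω} (hS : S.Finite) (hS' : S'.Finite)
    (h : levelPoly S = levelPoly S') : S = S' := by
  ext w
  rw [← eval_levelPoly_eq_zero_iff hS, h, eval_levelPoly_eq_zero_iff hS']

theorem coord_eq_zero_of_ncard_lt {S : Set Ω} (hS : S.Finite) {i : ℕ} (hi : S.ncard < i) :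
    coord S i = 0 :=
  coeff_eq_zero_of_natDegree_lt (p := levelPoly S) (by rwa [natDegree_levelPoly hS])

/-- Substituting cZ for Z in ∏(Z - cv) extracts a factor c from each term. This makes every
coordinate of G homogeneous under isomorphisms. -/
theorem coord_mul_left_image {S : Set Ω} (hS : S.Finite) {c : Ω} (hc : c ≠ 0) (i : ℕ) :
    coord ((c * ·) '' S) i = c ^ ((S.ncard : ℤ) - i) * coord S i := by
  have hinj : Function.Injective (c * · : Ω → Ω) := mul_right_injective₀ hc
  have h : (levelPoly ((c * ·) '' S)).comp (C c * X) = C (c ^ S.ncard) * levelPoly S := by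
    rw [levelPoly, finprod_mem_image hinj.injOn, levelPoly_eq_prod hS,
      finprod_mem_eq_finite_toFinset_prod _ hS, prod_comp, Set.ncard_eq_toFinset_card S hS, C_pow,
      ← Finset.prod_const, ← Finset.prod_mul_distrib]
    refine Finset.prod_congr rfl fun v _ => ?_
    simp [mul_sub]
  have h2 := congrArg (fun p => p.coeff i) h
  simp only [comp_C_mul_X_coeff, coeff_C_mul] at h2
  rw [coord_eq_coeff, coord_eq_coeff, zpow_sub₀ hc, zpow_natCast, zpow_natCast, div_mul_eq_mul_div,
    eq_div_iff (pow_ne_zero _ hc), ← h2]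

variable {Fq : Type u} [Field Fq] [Algebra Fq Ω]

theorem eval_levelPoly_add {V : Submodule Fq Ω} (hV : (V : Set Ω).Finite) {v : Ω} (hv : v ∈ V)
    (w : Ω) : (levelPoly (V : Set Ω)).eval (w + v) = (levelPoly (V : Set Ω)).eval w := by
  rw [eval_levelPoly hV, eval_levelPoly hV]
  refine Finset.prod_bij' (fun u _ => u - v) (fun u _ => u + v) ?_ ?_ ?_ ?_ ?_
  · intro u hu; simp only [Set.Finite.mem_toFinset, SetLike.mem_coe] at *; exact V.sub_mem hu hv
  · intro u hu; simp only [Set.Finite.mem_toFinset, SetLike.mem_coe] at *; exact V.add_mem hu hv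
  · intros; simp
  · intros; simp
  · intros; ring

theorem eval_levelPoly_smul [Fintype Fq] {V : Submodule Fq Ω} (hV : (V : Set Ω).Finite) (c : Fq)
    (w : Ω) : (levelPoly (V : Set Ω)).eval (c • w) = c • (levelPoly (V : Set Ω)).eval w := by
  by_cases hc : c = 0
  · subst hc
    rw [zero_smul, zero_smul, eval_levelPoly_eq_zero_iff hV]
    exact V.zero_mem
  rw [eval_levelPoly hV, eval_levelPoly hV]
  -- The factors contribute c to the power #V, and #V is a power of q.
  have hcard : c ^ hV.toFinset.card = c := by
    have : Fintype V := hV.fintype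
    rw [← Set.ncard_eq_toFinset_card _ hV]
    have h : (V : Set Ω).ncard = Fintype.card V := by
      rw [← Nat.card_eq_fintype_card]; rfl
    have : Module.Finite Fq V := Module.Finite.of_finite
    rw [h, Module.card_eq_pow_finrank (K := Fq) (V := V), FiniteField.pow_card_pow]
  conv_rhs => rw [← hcard, ← Finset.prod_const, ← Finset.prod_smul]
  refine Finset.prod_bij' (fun u _ => c⁻¹ • u) (fun u _ => c • u) ?_ ?_ ?_ ?_ ?_
  · intro u hu; simp only [Set.Finite.mem_toFinset, SetLike.mem_coe] at *; exact V.smul_mem _ hu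
  · intro u hu; simp only [Set.Finite.mem_toFinset, SetLike.mem_coe] at *; exact V.smul_mem _ hu
  · intros; simp [smul_smul, hc]
  · intros; simp [smul_smul, hc]
  · intros; simp [smul_sub, smul_smul, hc]

theorem IsGenerator.levelPoly_eq [Fintype Fq] {f : Module.End Fq Ω} {s : ℕ} {z : Ω} (hz : IsGenerator f s z) :
    levelPoly (orbitSpan f z : Set Ω) = ∏ a, (X - C (combo f s z a)) := by
  rw [levelPoly, ← hz.range_combo, finprod_mem_range hz.combo_injective, finprod_eq_prod_of_fintype]

end LevelPoly

/-! ### Existence of points, isomorphisms, and the fibres of the projections -/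

section PointsTheory

variable {Fq : Type u} [Field Fq] [Fintype Fq] {Ω : Type w} [Field Ω] [Algebra Fq Ω]
  {m j s : ℕ}

theorem scalar_apply (c v : Ω) : scalar Fq c v = c * v := rfl

theorem coe_map_scalar (G : Submodule Fq Ω) (c : Ω) :
    (G.map (scalar Fq c) : Set Ω) = (c * ·) '' (G : Set Ω) := rfl

theorem one_lt_card_pow {i : ℕ} (hi : 0 < i) : 1 < Fintype.card Fq ^ i :=
  Nat.one_lt_pow hi.ne' Fintype.one_lt_card

theorem card_pow_lt {i i' : ℕ} (h : i < i') : Fintype.card Fq ^ i < Fintype.card Fq ^ i' :=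
  Nat.pow_lt_pow_right Fintype.one_lt_card h

/-- The polynomial `g_m X^(q^m) + g_j X^(q^j) + X`. -/
def phiPoly (Fq : Type u) [Fintype Fq] (m j : ℕ) {R : Type*} [CommRing R] (gm gj : R) :
    Polynomial R :=
  C gm * X ^ Fintype.card Fq ^ m + C gj * X ^ Fintype.card Fq ^ j + X

theorem eval_phiPoly (gm gj v : Ω) :
    (phiPoly Fq m j gm gj).eval v = phiT Fq m j gm gj v := by
  simp [phiPoly, phiT_apply]

theorem coeff_phiPoly_top (hj : 0 < j) (hjm : j < m) (gm gj : Ω) :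
    (phiPoly Fq m j gm gj).coeff (Fintype.card Fq ^ m) = gm := by
  have h1 := (card_pow_lt (Fq := Fq) hjm).ne'
  have h2 := (one_lt_card_pow (Fq := Fq) (hj.trans hjm)).ne
  simp [phiPoly, coeff_X_pow, coeff_X, h1, h2]

theorem coeff_phiPoly_mid (hj : 0 < j) (hjm : j < m) (gm gj : Ω) :
    (phiPoly Fq m j gm gj).coeff (Fintype.card Fq ^ j) = gj := by
  have h1 := (card_pow_lt (Fq := Fq) hjm).ne
  have h2 := (one_lt_card_pow (Fq := Fq) hj).ne
  simp [phiPoly, coeff_X_pow, coeff_X, h1, h2]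

theorem degree_phiPoly_sub_C_ne_zero (hj : 0 < j) (hjm : j < m) {gm : Ω} (hgm : gm ≠ 0)
    (gj y : Ω) : (phiPoly Fq m j gm gj - C y).degree ≠ 0 := by
  intro h
  have h1 : (phiPoly Fq m j gm gj - C y).coeff (Fintype.card Fq ^ m) = gm := by
    rw [coeff_sub, coeff_phiPoly_top hj hjm, coeff_C,
      if_neg (pow_pos Fintype.card_pos m).ne', sub_zero]
  rw [eq_C_of_degree_eq_zero h, coeff_C, if_neg (pow_pos Fintype.card_pos m).ne'] at h1
  exact hgm h1.symm

theorem phiT_surjective [IsAlgClosed Ω] (hj : 0 < j) (hjm : j < m) {gm : Ω} (hgm : gm ≠ 0)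
    (gj : Ω) : Function.Surjective (phiT Fq m j gm gj) := by
  intro y
  obtain ⟨v, hv⟩ := IsAlgClosed.exists_root _
    (degree_phiPoly_sub_C_ne_zero (Fq := Fq) hj hjm hgm gj y)
  refine ⟨v, ?_⟩
  rw [IsRoot, eval_sub, eval_phiPoly, eval_C, sub_eq_zero] at hv
  exact hv

theorem exists_phiT_eq_zero [IsAlgClosed Ω] (hj : 0 < j) (hjm : j < m) {gm : Ω} (hgm : gm ≠ 0)
    (gj : Ω) : ∃ x ≠ 0, phiT Fq m j gm gj x = 0 := by
  have hm1 := one_lt_card_pow (Fq := Fq) (hj.trans hjm)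
  have hj1 := one_lt_card_pow (Fq := Fq) hj
  have hlt := card_pow_lt (Fq := Fq) hjm
  -- This is φ_T(Z)/Z; its constant term is 1, so none of its roots is zero.
  set P : Polynomial Ω := C gm * X ^ (Fintype.card Fq ^ m - 1) +
    C gj * X ^ (Fintype.card Fq ^ j - 1) + 1
  have hdeg : P.degree ≠ 0 := by
    intro h
    have h1 : P.coeff (Fintype.card Fq ^ m - 1) = gm := by
      have h2 : Fintype.card Fq ^ m - 1 ≠ Fintype.card Fq ^ j - 1 := by omega
      have h3 : Fintype.card Fq ^ m - 1 ≠ 0 := by omega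
      simp [P, coeff_X_pow, coeff_one, h2, h3]
    rw [eq_C_of_degree_eq_zero h, coeff_C, if_neg (by omega)] at h1
    exact hgm h1.symm
  obtain ⟨x, hx⟩ := IsAlgClosed.exists_root P hdeg
  have hx' : gm * x ^ (Fintype.card Fq ^ m - 1) + gj * x ^ (Fintype.card Fq ^ j - 1) + 1 = 0 := by
    simpa [P, IsRoot] using hx
  refine ⟨x, ?_, ?_⟩
  · rintro rfl
    rw [zero_pow (by omega), zero_pow (by omega)] at hx'
    simp at hx'
  · rw [phiT_apply]
    obtain ⟨a, ha⟩ : ∃ a, Fintype.card Fq ^ m = a + 1 := ⟨_, (Nat.sub_add_cancel hm1.le).symm⟩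
    obtain ⟨b, hb⟩ : ∃ b, Fintype.card Fq ^ j = b + 1 := ⟨_, (Nat.sub_add_cancel hj1.le).symm⟩
    rw [ha, hb] at hx' ⊢
    simp only [Nat.add_sub_cancel] at hx'
    linear_combination x * hx'

theorem exists_isGenerator [IsAlgClosed Ω] (hj : 0 < j) (hjm : j < m) {gm : Ω} (hgm : gm ≠ 0)
    (gj : Ω) (s : ℕ) : ∃ z, IsGenerator (phiT Fq m j gm gj) s z := by
  obtain ⟨x, hx0, hx⟩ := exists_phiT_eq_zero (Fq := Fq) hj hjm hgm gj
  have hsurj : Function.Surjective ⇑(phiT Fq m j gm gj ^ s) := by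
    rw [Module.End.coe_pow]
    exact (phiT_surjective hj hjm hgm gj).iterate s
  obtain ⟨z, hz⟩ := hsurj x
  exact ⟨z, by rw [pow_succ', Module.End.mul_apply, hz, hx], by rwa [hz]⟩

/-- The criterion for `c` to be an isomorphism of Drinfeld modules. -/
theorem scalar_mul_phiT_iff [Infinite Ω] (hj : 0 < j) (hjm : j < m) {c gm gj gm' gj' : Ω} :
    scalar Fq c * phiT Fq m j gm gj = phiT Fq m j gm' gj' * scalar Fq c ↔
      gm' * c ^ Fintype.card Fq ^ m = c * gm ∧ gj' * c ^ Fintype.card Fq ^ j = c * gj := by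
  constructor
  · intro h
    -- Over the infinite field Ω an identity of functions is an identity of polynomials, whose
    -- coefficients can be compared.
    have hp : C c * phiPoly Fq m j gm gj = (phiPoly Fq m j gm' gj').comp (C c * X) := by
      refine Polynomial.funext fun v => ?_
      have := LinearMap.congr_fun h v
      simp only [Module.End.mul_apply, scalar_apply] at this
      rw [eval_mul, eval_C, eval_phiPoly, this, eval_comp, eval_phiPoly]
      simp
    have h1 := congrArg (fun p => p.coeff (Fintype.card Fq ^ m)) hp
    have h2 := congrArg (fun p => p.coeff (Fintype.card Fq ^ j)) hp
    simp only [coeff_C_mul, comp_C_mul_X_coeff, coeff_phiPoly_top hj hjm,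
      coeff_phiPoly_mid hj hjm] at h1 h2
    exact ⟨h1.symm, h2.symm⟩
  · rintro ⟨h1, h2⟩
    ext v
    simp only [Module.End.mul_apply, scalar_apply, phiT_apply, mul_pow]
    linear_combination (-v ^ Fintype.card Fq ^ m) * h1 - v ^ Fintype.card Fq ^ j * h2

theorem IsGenerator.smul {f : Module.End Fq Ω} {z : Ω} (hz : IsGenerator f s z) {c : Fq}
    (hc : c ≠ 0) : IsGenerator f s (c • z) :=
  ⟨by rw [map_smul, hz.1, smul_zero], by rw [map_smul]; exact smul_ne_zero hc hz.2⟩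

theorem orbitSpan_smul (f : Module.End Fq Ω) (z : Ω) {c : Fq} (hc : c ≠ 0) :
    orbitSpan f (c • z) = orbitSpan f z := by
  ext v
  rw [mem_orbitSpan, mem_orbitSpan]
  constructor
  · rintro ⟨p, rfl⟩
    exact ⟨c • p, by simp⟩
  · rintro ⟨p, rfl⟩
    exact ⟨c⁻¹ • p, by simp [smul_smul, hc]⟩

/-- Any generator of G has T^s z on the socle line, so a rescaling by `Fq` makes T^s z equal to the
marked point. -/
theorem Triple.exists_generator (P : Triple Fq Ω m j (X ^ (s + 1))) :
    ∃ z, IsGenerator (phiT Fq m j (-1) P.gj) s z ∧ P.G = orbitSpan (phiT Fq m j (-1) P.gj) z ∧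
      (phiT Fq m j (-1) P.gj ^ s) z = P.x := by
  obtain ⟨z, hz, hG⟩ := isLevel_X_pow_iff.1 P.level
  obtain ⟨c, hc⟩ := hz.exists_smul_of_apply_eq_zero (hG ▸ P.x_mem) P.x_ker
  have hc0 : c ≠ 0 := by
    rintro rfl
    exact P.x_ne (by rw [hc, zero_smul])
  exact ⟨c • z, hz.smul hc0, by rw [orbitSpan_smul _ _ hc0, hG], by rw [map_smul, hc]⟩

theorem isLevel_finite {f : Module.End Fq Ω} {G : Submodule Fq Ω}
    (h : IsLevel Fq f (X ^ (s + 1)) G) : (G : Set Ω).Finite := by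
  obtain ⟨z, hz, rfl⟩ := isLevel_X_pow_iff.1 h
  exact hz.finite

theorem isLevel_ncard {f : Module.End Fq Ω} {G : Submodule Fq Ω}
    (h : IsLevel Fq f (X ^ (s + 1)) G) : (G : Set Ω).ncard = Fintype.card Fq ^ (s + 1) := by
  obtain ⟨z, hz, rfl⟩ := isLevel_X_pow_iff.1 h
  exact hz.ncard

theorem isLevel_coord_eq_zero {f : Module.End Fq Ω} {G : Submodule Fq Ω}
    (h : IsLevel Fq f (X ^ (s + 1)) G) {i : ℕ} (hi : Fintype.card Fq ^ (s + 1) < i) :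
    coord (G : Set Ω) i = 0 :=
  coord_eq_zero_of_ncard_lt (isLevel_finite h) (by rwa [isLevel_ncard h])

theorem isLevel_coord_map {f : Module.End Fq Ω} {G : Submodule Fq Ω}
    (h : IsLevel Fq f (X ^ (s + 1)) G) {c : Ω} (hc : c ≠ 0) (i : ℕ) :
    coord (G.map (scalar Fq c) : Set Ω) i =
      c ^ (((Fintype.card Fq ^ (s + 1) : ℕ) : ℤ) - i) * coord (G : Set Ω) i := by
  rw [coe_map_scalar, coord_mul_left_image (isLevel_finite h) hc, isLevel_ncard h]

theorem isLevel_ext {f f' : Module.End Fq Ω} {G G' : Submodule Fq Ω}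
    (h : IsLevel Fq f (X ^ (s + 1)) G) (h' : IsLevel Fq f' (X ^ (s + 1)) G')
    (hc : ∀ i, coord (G : Set Ω) i = coord (G' : Set Ω) i) : G = G' :=
  SetLike.coe_injective (levelPoly_injOn (isLevel_finite h) (isLevel_finite h')
    (Polynomial.ext hc))

theorem Triple.ext_of_G_of_x {N : Fq[X]} {P P' : Triple Fq Ω m j N} (hG : P.G = P'.G)
    (hx : P.x = P'.x) : P = P' := by
  refine Triple.ext ?_ hG hx
  rw [← gOf_eq P.x_ne P.x_ker, ← gOf_eq P'.x_ne P'.x_ker, hx]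

theorem Triple.exists_of_gj [IsAlgClosed Ω] (hj : 0 < j) (hjm : j < m) (gj : Ω) :
    ∃ P : Triple Fq Ω m j (X ^ (s + 1)), P.gj = gj := by
  obtain ⟨z, hz⟩ := exists_isGenerator (Fq := Fq) hj hjm (neg_ne_zero.2 one_ne_zero) gj s
  exact ⟨⟨gj, orbitSpan _ z, (phiT Fq m j (-1) gj ^ s) z, isLevel_X_pow_iff.2 ⟨z, hz, rfl⟩,
    pow_apply_mem_orbitSpan s, by rw [← Module.End.mul_apply, ← pow_succ', hz.1], hz.2⟩, rfl⟩

theorem pi1_surjective : Function.Surjective (pi1 Fq Ω m j (X ^ (s + 1))) := by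
  intro P
  obtain ⟨z, hz, hG⟩ := isLevel_X_pow_iff.1 P.level
  exact ⟨⟨P.gj, P.G, (phiT Fq m j (-1) P.gj ^ s) z, P.level,
    hG ▸ pow_apply_mem_orbitSpan s, by rw [← Module.End.mul_apply, ← pow_succ', hz.1], hz.2⟩, rfl⟩

theorem exists_normalized [IsAlgClosed Ω] (hj : 0 < j) (hjm : j < m) {N : Fq[X]}
    (P : Pair Fq Ω m j N) : ∃ (c : Ω) (P' : NPair Fq Ω m j N), c ≠ 0 ∧ IsIsom c P P'.toPair := by
  have hm1 := one_lt_card_pow (Fq := Fq) (hj.trans hjm)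
  -- Conjugation by c multiplies g_m by c^(1 - q^m); the result is to be -1.
  obtain ⟨c, hc⟩ := IsAlgClosed.exists_pow_nat_eq (-P.gm)
    (show 0 < Fintype.card Fq ^ m - 1 by omega)
  have hc0 : c ≠ 0 := by
    rintro rfl
    rw [zero_pow (by omega), eq_comm, neg_eq_zero] at hc
    exact P.gm_ne hc
  have hs : scalar Fq c * phiT Fq m j P.gm P.gj =
      phiT Fq m j (-1) (c * P.gj / c ^ Fintype.card Fq ^ j) * scalar Fq c := by
    refine (scalar_mul_phiT_iff hj hjm).2 ⟨?_, div_mul_cancel₀ _ (pow_ne_zero _ hc0)⟩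
    rw [← Nat.sub_add_cancel hm1.le, pow_succ, hc]
    ring
  exact ⟨c, ⟨_, P.G.map (scalar Fq c), P.level.map hc0 hs⟩, hc0, hs, rfl⟩

theorem pi2_surjective [IsAlgClosed Ω] (hj : 0 < j) (hjm : j < m) {N : Fq[X]} :
    Function.Surjective (pi2 Fq Ω m j N) := by
  intro c
  induction c using Quotient.inductionOn with
  | h P =>
    obtain ⟨c, P', hc, h⟩ := exists_normalized hj hjm P
    exact ⟨P', (Quotient.sound (s := pairSetoid Fq Ω m j N) ⟨c, hc, h⟩).symm⟩

theorem pi3_surjective [IsAlgClosed Ω] (hj : 0 < j) (hjm : j < m) :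
    Function.Surjective (pi3 Fq Ω m j (X ^ (s + 1))) :=
  (pi2_surjective hj hjm).comp pi1_surjective

theorem IsIsom.gm_eq [Infinite Ω] (hj : 0 < j) (hjm : j < m) {N : Fq[X]} {c : Ω} (hc : c ≠ 0)
    {P P' : Pair Fq Ω m j N} (h : IsIsom c P P') :
    P'.gm = c ^ (1 - ((Fintype.card Fq ^ m : ℕ) : ℤ)) * P.gm := by
  have := ((scalar_mul_phiT_iff hj hjm).1 h.1).1
  rw [zpow_sub₀ hc, zpow_one, zpow_natCast, div_mul_eq_mul_div, eq_div_iff (pow_ne_zero _ hc), this]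

theorem IsIsom.gj_eq [Infinite Ω] (hj : 0 < j) (hjm : j < m) {N : Fq[X]} {c : Ω} (hc : c ≠ 0)
    {P P' : Pair Fq Ω m j N} (h : IsIsom c P P') :
    P'.gj = c ^ (1 - ((Fintype.card Fq ^ j : ℕ) : ℤ)) * P.gj := by
  have := ((scalar_mul_phiT_iff hj hjm).1 h.1).2
  rw [zpow_sub₀ hc, zpow_one, zpow_natCast, div_mul_eq_mul_div, eq_div_iff (pow_ne_zero _ hc), this]

theorem IsIsom.coord_eq {c : Ω} (hc : c ≠ 0) {P P' : Pair Fq Ω m j (X ^ (s + 1))}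
    (h : IsIsom c P P') (i : ℕ) : coord (P'.G : Set Ω) i =
      c ^ (((Fintype.card Fq ^ (s + 1) : ℕ) : ℤ) - i) * coord (P.G : Set Ω) i := by
  rw [← h.2, isLevel_coord_map P.level hc]

variable {K : Type v} [Field K] [Algebra Fq K] [Algebra K Ω]

theorem algebraMap_unit_ne_zero (μ : Kˣ) : algebraMap K Ω μ ≠ 0 :=
  (_root_.map_ne_zero _).2 μ.ne_zero

theorem isIsom_scale {N : Fq[X]} (hK : Module.finrank Fq K = m) (hm : 0 < m) (μ : Kˣ)
    (P : Triple Fq Ω m j N) : IsIsom (algebraMap K Ω μ) (pi1 Fq Ω m j N P).toPair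
      (pi1 Fq Ω m j N (scale hK hm μ P)).toPair :=
  ⟨scalar_mul_phiT hK hm μ P.x_ne P.x_ker, rfl⟩

theorem pi3_scale {N : Fq[X]} (hK : Module.finrank Fq K = m) (hm : 0 < m) (μ : Kˣ)
    (P : Triple Fq Ω m j N) : pi3 Fq Ω m j N (scale hK hm μ P) = pi3 Fq Ω m j N P :=
  (Quotient.sound (s := pairSetoid Fq Ω m j N)
    ⟨_, algebraMap_unit_ne_zero μ, isIsom_scale hK hm μ P⟩).symm

theorem map_scalar_algebraMap (G : Submodule Fq Ω) {c : Fq} (hc : c ≠ 0) :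
    G.map (scalar Fq (algebraMap Fq Ω c)) = G := by
  ext v
  rw [Submodule.mem_map]
  constructor
  · rintro ⟨u, hu, rfl⟩
    rw [scalar_apply, ← Algebra.smul_def]
    exact G.smul_mem _ hu
  · intro hv
    exact ⟨c⁻¹ • v, G.smul_mem _ hv, by rw [scalar_apply, ← Algebra.smul_def, smul_smul]; simp [hc]⟩

theorem scale_fq_gj [IsScalarTower Fq K Ω] [Infinite Ω] {N : Fq[X]} (hj : 0 < j) (hjm : j < m)
    (hK : Module.finrank Fq K = m) (hm : 0 < m) (μ : Fqˣ) (P : Triple Fq Ω m j N) :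
    (scale hK hm (Units.map (algebraMap Fq K : Fq →* K) μ) P).gj = P.gj := by
  have h := ((scalar_mul_phiT_iff hj hjm).1
    (isIsom_scale hK hm (Units.map (algebraMap Fq K : Fq →* K) μ) P).1).2
  have e : algebraMap K Ω (Units.map (algebraMap Fq K : Fq →* K) μ : Kˣ) =
      algebraMap Fq Ω μ := by
    simp [← IsScalarTower.algebraMap_apply]
  rw [e, ← map_pow, FiniteField.pow_card_pow, mul_comm] at h
  exact mul_left_cancel₀ ((_root_.map_ne_zero _).2 μ.ne_zero) h

theorem pi1_scale_fq [IsScalarTower Fq K Ω] [Infinite Ω] {N : Fq[X]} (hj : 0 < j) (hjm : j < m)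
    (hK : Module.finrank Fq K = m) (hm : 0 < m) (μ : Fqˣ) (P : Triple Fq Ω m j N) :
    pi1 Fq Ω m j N (scale hK hm (Units.map (algebraMap Fq K : Fq →* K) μ) P) =
      pi1 Fq Ω m j N P := by
  refine NPair.ext (scale_fq_gj hj hjm hK hm μ P) ?_
  change P.G.map (scalar Fq (algebraMap K Ω _)) = P.G
  rw [Units.coe_map, MonoidHom.coe_coe, ← IsScalarTower.algebraMap_apply,
    map_scalar_algebraMap _ μ.ne_zero]

/-- The images of the elements of K already account for as many roots of Z^#K - Z as its degree
allows. -/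
theorem mem_range_of_pow_card_eq [Fintype K] {c : Ω} (h : c ^ Fintype.card K = c) :
    c ∈ (algebraMap K Ω).range := by
  classical
  by_contra hc
  have hne : (X ^ Fintype.card K - X : Polynomial Ω) ≠ 0 :=
    FiniteField.X_pow_card_sub_X_ne_zero Ω Fintype.one_lt_card
  have hc' : c ∉ Finset.univ.image (algebraMap K Ω) := by
    simpa using hc
  have hsub : (insert c (Finset.univ.image (algebraMap K Ω))).val ⊆
      (X ^ Fintype.card K - X : Polynomial Ω).roots := by
    intro v hv
    rw [mem_roots hne]
    rw [Finset.mem_val, Finset.mem_insert, Finset.mem_image] at hv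
    rcases hv with rfl | ⟨a, -, rfl⟩
    · simp [h]
    · simp [← map_pow, FiniteField.pow_card]
  have := card_le_degree_of_subset_roots hsub
  rw [FiniteField.X_pow_card_sub_X_natDegree_eq Ω Fintype.one_lt_card,
    Finset.card_insert_of_notMem hc',
    Finset.card_image_of_injective _ (algebraMap K Ω).injective, Finset.card_univ] at this
  omega

theorem pi1_fibre [IsScalarTower Fq K Ω] [Infinite Ω] (hj : 0 < j) (hjm : j < m)
    (hK : Module.finrank Fq K = m) (hm : 0 < m) (y y' : Triple Fq Ω m j (X ^ (s + 1))) :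
    pi1 Fq Ω m j _ y = pi1 Fq Ω m j _ y' ↔
      ∃! μ : Fqˣ, scale hK hm (Units.map (algebraMap Fq K : Fq →* K) μ) y = y' := by
  constructor
  · intro h
    have hG : y.G = y'.G := congrArg NPair.G h
    have hg : y.gj = y'.gj := congrArg NPair.gj h
    obtain ⟨z, hz, hz', hzx⟩ := y.exists_generator
    obtain ⟨c, hc⟩ := hz.exists_smul_of_apply_eq_zero (v := y'.x) (hz' ▸ hG ▸ y'.x_mem)
      (by rw [hg]; exact y'.x_ker)
    rw [hzx] at hc
    have hc0 : c ≠ 0 := by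
      rintro rfl
      exact y'.x_ne (by rw [hc, zero_smul])
    have hx : ∀ μ : Fqˣ, (scale hK hm (Units.map (algebraMap Fq K : Fq →* K) μ) y).x =
        (μ : Fq) • y.x := fun μ => by
      change algebraMap K Ω (algebraMap Fq K μ) * y.x = _
      rw [← IsScalarTower.algebraMap_apply, Algebra.smul_def]
    refine ⟨Units.mk0 c hc0, Triple.ext_of_G_of_x ?_ ?_, fun μ hμ => ?_⟩
    · rw [← hG]
      exact congrArg NPair.G (pi1_scale_fq hj hjm hK hm (Units.mk0 c hc0) y)
    · rw [hx, hc, Units.val_mk0]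
    · have := congrArg Triple.x hμ
      rw [hx, hc] at this
      exact Units.ext (smul_left_injective Fq y.x_ne this)
  · rintro ⟨μ, rfl, -⟩
    exact (pi1_scale_fq hj hjm hK hm μ y).symm

theorem pi3_fibre [IsScalarTower Fq K Ω] [Infinite Ω] (hj : 0 < j) (hjm : j < m)
    (hK : Module.finrank Fq K = m) (hm : 0 < m) (y y' : Triple Fq Ω m j (X ^ (s + 1))) :
    pi3 Fq Ω m j _ y = pi3 Fq Ω m j _ y' ↔ ∃! μ : Kˣ, scale hK hm μ y = y' := by
  have hfin : Module.Finite Fq K := Module.finite_of_finrank_pos (hK ▸ hm)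
  have hfin' : Finite K := Module.finite_of_finite Fq
  have := Fintype.ofFinite K
  constructor
  · intro h
    obtain ⟨c, hc0, hc⟩ := Quotient.exact h
    have hcm := ((scalar_mul_phiT_iff hj hjm).1 hc.1).1
    -- Both leading coefficients are -1, which forces c^(q^m) = c.
    have hcK : c ∈ (algebraMap K Ω).range := by
      refine mem_range_of_pow_card_eq ?_
      rw [Module.card_eq_pow_finrank (K := Fq), hK]
      simpa [NPair.toPair] using hcm
    obtain ⟨c, rfl⟩ := hcK
    have hc0' : c ≠ 0 := fun h => hc0 (by rw [h, map_zero])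
    have hG : y.G.map (scalar Fq (algebraMap K Ω c)) = y'.G := hc.2
    obtain ⟨z, hz, hz', hzx⟩ := y'.exists_generator
    -- c may send x to a different point of the socle of `y'.G`; dividing by d corrects this and,
    -- since d lies in `Fq`, does not change the image of G.
    obtain ⟨d, hd⟩ := hz.exists_smul_of_apply_eq_zero (v := algebraMap K Ω c * y.x)
      (hz' ▸ hG ▸ ⟨_, y.x_mem, rfl⟩) (by
        have := LinearMap.congr_fun hc.1 y.x
        rw [Module.End.mul_apply, Module.End.mul_apply] at this
        refine this.symm.trans ?_
        change scalar Fq _ (phiT Fq m j (-1) y.gj y.x) = 0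
        rw [y.x_ker, map_zero])
    rw [hzx, Algebra.smul_def, IsScalarTower.algebraMap_apply Fq K Ω] at hd
    have hd0 : d ≠ 0 := by
      rintro rfl
      rw [map_zero, map_zero, zero_mul, mul_eq_zero] at hd
      exact hd.elim hc0 y.x_ne
    have hdK : algebraMap Fq K d ≠ 0 := (_root_.map_ne_zero _).2 hd0
    have hx : algebraMap K Ω ((algebraMap Fq K d)⁻¹ * c) * y.x = y'.x := by
      rw [map_mul, mul_assoc, hd, map_inv₀, inv_mul_cancel_left₀ ((_root_.map_ne_zero _).2 hdK)]
    refine ⟨Units.mk0 ((algebraMap Fq K d)⁻¹ * c) (mul_ne_zero (inv_ne_zero hdK) hc0'),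
      Triple.ext_of_G_of_x ?_ hx, fun μ hμ => ?_⟩
    · change y.G.map (scalar Fq (algebraMap K Ω ((algebraMap Fq K d)⁻¹ * c))) = y'.G
      rw [map_mul, scalar_mul, Module.End.mul_eq_comp, Submodule.map_comp, hG, ← map_inv₀,
        ← IsScalarTower.algebraMap_apply, map_scalar_algebraMap _ (inv_ne_zero hd0)]
    · have h1 : algebraMap K Ω μ * y.x = y'.x := congrArg Triple.x hμ
      rw [← hx] at h1
      exact Units.ext ((algebraMap K Ω).injective (mul_right_cancel₀ y.x_ne h1))
  · rintro ⟨μ, rfl, -⟩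
    exact (pi3_scale hK hm μ y).symm

end PointsTheory

/-! ### Integrality of torsion points and lifting of characters -/

theorem isIntegral_of_pow_eq {R A : Type*} [CommRing R] [CommRing A] [Algebra R A] {x y : A}
    (r : R) {a b : ℕ} (hb : b < a) (ha : 1 < a) (hy : IsIntegral R y)
    (h : x ^ a = algebraMap R A r * x ^ b + x - y) : IsIntegral R x := by
  nontriviality A
  have : Nontrivial (integralClosure R A) := inferInstance
  let y' : integralClosure R A := ⟨y, hy⟩
  have : Algebra.IsIntegral R (integralClosure R A) := inferInstance
  -- The monic equation for x has y among its coefficients, so it lives over the integral closure;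
  -- transitivity brings it down to R.
  refine isIntegral_trans (A := integralClosure R A) x
    ⟨X ^ a + (-(C (algebraMap R _ r) * X ^ b + X - C y')), monic_X_pow_add ?_, ?_⟩
  · have ha' : ((1 : ℕ) : WithBot ℕ) < a := by exact_mod_cast ha
    have hb' : ((b : ℕ) : WithBot ℕ) < a := by exact_mod_cast hb
    rw [degree_neg]
    refine (degree_sub_le _ _).trans_lt (max_lt ((degree_add_le _ _).trans_lt (max_lt ?_ ?_)) ?_)
    · exact (degree_C_mul_X_pow_le _ _).trans_lt hb'
    · exact degree_X_le.trans_lt ha'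
    · exact degree_C_le.trans_lt (by exact_mod_cast zero_lt_one.trans ha)
  · have e1 : algebraMap (integralClosure R A) A y' = y := rfl
    simp only [eval₂_add, eval₂_neg, eval₂_sub, eval₂_mul, eval₂_X, eval₂_C, eval₂_pow, e1, h, ← IsScalarTower.algebraMap_apply]
    ring

section Integrality

variable {Fq : Type u} [Field Fq] [Fintype Fq] {Ω : Type w} [Field Ω] [Algebra Fq Ω]
  {m j s : ℕ} {K : Type v} [Field K] [Algebra Fq K] [Algebra K Ω] [IsScalarTower Fq K Ω]
  {T : Type*} {g ζ : T → Ω} {R : Subalgebra K (T → Ω)}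

variable (Fq m j g ζ) in
/-- The function `f ^ k ζ`, where `f = -τ^m + g τ^j + 1`. -/
def iterFun (k : ℕ) (t : T) : Ω := (phiT Fq m j (-1) (g t) ^ k) (ζ t)

theorem iterFun_succ (k : ℕ) : iterFun Fq m j g ζ (k + 1) =
    -iterFun Fq m j g ζ k ^ Fintype.card Fq ^ m +
      g * iterFun Fq m j g ζ k ^ Fintype.card Fq ^ j + iterFun Fq m j g ζ k := by
  funext t
  simp [iterFun, pow_succ', Module.End.mul_apply, phiT_apply]

/-- Descending induction from T^(s+1) ζ = 0: T^k ζ is a root of Z^(q^m) - g Z^(q^j) - Z + T^(k+1) ζ.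
-/
theorem isIntegral_iterFun (hj : 0 < j) (hjm : j < m) (hg : g ∈ R)
    (hζ : ∀ t, IsGenerator (phiT Fq m j (-1) (g t)) s (ζ t)) (k : ℕ) :
    IsIntegral R (iterFun Fq m j g ζ k) := by
  rcases Nat.lt_or_ge (s + 1) k with hk | hk
  · have : iterFun Fq m j g ζ k = 0 := funext fun t => by
      rw [iterFun, ← Nat.sub_add_cancel hk.le, pow_add, Module.End.mul_apply, (hζ t).1, map_zero]
      rfl
    rw [this]
    exact isIntegral_zero
  induction hk using Nat.decreasingInduction with
  | self =>
    have : iterFun Fq m j g ζ (s + 1) = 0 := funext fun t => (hζ t).1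
    rw [this]
    exact isIntegral_zero
  | of_succ k h ih =>
    refine isIntegral_of_pow_eq (⟨g, hg⟩ : R) (card_pow_lt (Fq := Fq) hjm)
      (one_lt_card_pow (Fq := Fq) (hj.trans hjm)) ih ?_
    have e : algebraMap R (T → Ω) ⟨g, hg⟩ = g := rfl
    rw [iterFun_succ, e]
    ring

/-- Dividing φ_T(x) = 0 by x² gives x⁻¹ = x^(q^m - 2) - g x^(q^j - 2) for x = T^s ζ. Invertibility
of this function keeps its image nonzero under every character. -/
theorem isIntegral_inv_iterFun (hj : 0 < j) (hjm : j < m) (hg : g ∈ R)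
    (hζ : ∀ t, IsGenerator (phiT Fq m j (-1) (g t)) s (ζ t)) :
    IsIntegral R (iterFun Fq m j g ζ s)⁻¹ := by
  have hI := isIntegral_iterFun hj hjm hg hζ s
  have hm1 := one_lt_card_pow (Fq := Fq) (hj.trans hjm)
  have hj1 := one_lt_card_pow (Fq := Fq) hj
  obtain ⟨a, ha⟩ : ∃ a, Fintype.card Fq ^ m = a + 2 := ⟨_, (Nat.sub_add_cancel hm1).symm⟩
  obtain ⟨b, hb⟩ : ∃ b, Fintype.card Fq ^ j = b + 2 := ⟨_, (Nat.sub_add_cancel hj1).symm⟩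
  have e : (iterFun Fq m j g ζ s)⁻¹ =
      iterFun Fq m j g ζ s ^ a - g * iterFun Fq m j g ζ s ^ b := by
    funext t
    have h0 : iterFun Fq m j g ζ s t ≠ 0 := (hζ t).2
    have h1 : iterFun Fq m j g ζ (s + 1) t = 0 := (hζ t).1
    rw [iterFun_succ, ha, hb] at h1
    simp only [Pi.add_apply, Pi.neg_apply, Pi.mul_apply, Pi.pow_apply, Pi.inv_apply,
      Pi.sub_apply] at h1 ⊢
    refine inv_eq_of_mul_eq_one_right (mul_left_cancel₀ h0 ?_)
    linear_combination -h1
  rw [e]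
  exact (hI.pow a).sub ((isIntegral_algebraMap (x := (⟨g, hg⟩ : R))).mul (hI.pow b))

variable (s) in
/-- The product of the `X - ∑ a_i Z_i` over all `a`. -/
def comboPoly {S : Type*} [CommRing S] (κ : Fq →+* S) (Z : ℕ → S) : Polynomial S :=
  ∏ a : Fin (s + 1) → Fq, (X - C (∑ i, κ (a i) * Z i))

theorem map_comboPoly {S : Type*} [CommRing S] {κ : Fq →+* S} {Z : ℕ → S} {e : S →+* Ω}
    {f : Module.End Fq Ω} {z : Ω} (hz : IsGenerator f s z) (hκ : ∀ c, e (κ c) = algebraMap Fq Ω c)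
    (hZ : ∀ i, e (Z i) = (f ^ i) z) :
    (comboPoly s κ Z).map e = levelPoly (orbitSpan f z : Set Ω) := by
  rw [hz.levelPoly_eq, comboPoly, Polynomial.map_prod]
  refine Finset.prod_congr rfl fun a _ => ?_
  rw [Polynomial.map_sub, map_X, map_C]
  simp only [combo, map_sum, map_mul, hκ, hZ, Algebra.smul_def]

/-- Each coordinate is a universal polynomial over `Fq` in the iterates of ζ; it is therefore
integral and compatible with ring homomorphisms. -/
theorem coord_orbitSpan_eq {S : Type*} [CommRing S] {κ : Fq →+* S} {Z : ℕ → S}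
    {ι : S →+* (T → Ω)} (hκ : ∀ c t, ι (κ c) t = algebraMap Fq Ω c)
    (hZ : ∀ i, ι (Z i) = iterFun Fq m j g ζ i)
    (hζ : ∀ t, IsGenerator (phiT Fq m j (-1) (g t)) s (ζ t)) (i : ℕ) :
    (fun t => coord (orbitSpan (phiT Fq m j (-1) (g t)) (ζ t) : Set Ω) i) =
      ι ((comboPoly s κ Z).coeff i) := by
  funext t
  rw [coord_eq_coeff, ← map_comboPoly (e := (Pi.evalRingHom _ t).comp ι) (hζ t) (fun c => hκ c t)
    (fun i => congrFun (hZ i) t), coeff_map]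
  rfl

theorem isIntegral_coord (hj : 0 < j) (hjm : j < m) (hg : g ∈ R)
    (hζ : ∀ t, IsGenerator (phiT Fq m j (-1) (g t)) s (ζ t)) (i : ℕ) :
    IsIntegral R (fun t => coord (orbitSpan (phiT Fq m j (-1) (g t)) (ζ t) : Set Ω) i) := by
  let Z : ℕ → integralClosure R (T → Ω) := fun k => ⟨_, isIntegral_iterFun hj hjm hg hζ k⟩
  let κ : Fq →+* integralClosure R (T → Ω) :=
    (algebraMap R _).comp ((algebraMap K R).comp (algebraMap Fq K))
  rw [coord_orbitSpan_eq (κ := κ) (Z := Z) (ι := (integralClosure R (T → Ω)).val.toRingHom)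
    (fun c t => (IsScalarTower.algebraMap_apply Fq K Ω c).symm) (fun i => rfl) hζ]
  exact Subtype.prop _

/-- The generator is χ(Z 0). The relations Z (k+1) = φ_T(Z k) and Z (s+1) = 0 are preserved by χ,
and Z s is a unit, so its image is not zero. -/
theorem exists_generator_of_ringHom {S : Type*} [CommRing S] {κ : Fq →+* S} {Z : ℕ → S}
    {ι : S →+* (T → Ω)} (hι : Function.Injective ι) (hκ : ∀ c t, ι (κ c) t = algebraMap Fq Ω c)
    (hZ : ∀ i, ι (Z i) = iterFun Fq m j g ζ i)
    (hζ : ∀ t, IsGenerator (phiT Fq m j (-1) (g t)) s (ζ t)) {g' W : S} (hg' : ι g' = g)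
    (hW : ι W = (iterFun Fq m j g ζ s)⁻¹) (χ : S →+* Ω) (hχ : ∀ c, χ (κ c) = algebraMap Fq Ω c) :
    ∃ z, IsGenerator (phiT Fq m j (-1) (χ g')) s z ∧
      (∀ (i : ℕ) (h : S),
        ι h = (fun t => coord (orbitSpan (phiT Fq m j (-1) (g t)) (ζ t) : Set Ω) i) →
        χ h = coord (orbitSpan (phiT Fq m j (-1) (χ g')) z : Set Ω) i) ∧
      ∀ h : S, ι h = iterFun Fq m j g ζ s → χ h = (phiT Fq m j (-1) (χ g') ^ s) z := by
  have hiter : ∀ k, χ (Z k) = (phiT Fq m j (-1) (χ g') ^ k) (χ (Z 0)) := by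
    intro k
    induction k with
    | zero => simp
    | succ k ih =>
      have e : Z (k + 1) = -Z k ^ Fintype.card Fq ^ m + g' * Z k ^ Fintype.card Fq ^ j + Z k := by
        apply hι
        rw [hZ, iterFun_succ]
        simp only [map_add, map_neg, map_mul, map_pow, hZ, hg']
      rw [e, pow_succ', Module.End.mul_apply, ← ih, phiT_apply]
      simp
  have hgen : IsGenerator (phiT Fq m j (-1) (χ g')) s (χ (Z 0)) := by
    constructor
    · have : Z (s + 1) = 0 := hι (by rw [hZ, map_zero]; exact funext fun t => (hζ t).1)
      rw [← hiter, this, map_zero]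
    · rw [← hiter]
      have h1 : Z s * W = 1 := hι (by
        rw [map_mul, hZ, hW, map_one]
        exact funext fun t => mul_inv_cancel₀ (hζ t).2)
      intro h0
      have := congrArg χ h1
      rw [map_mul, h0, zero_mul, map_one] at this
      exact zero_ne_one this
  refine ⟨χ (Z 0), hgen, fun i h hh => ?_, fun h hh => ?_⟩
  · have e : h = (comboPoly s κ Z).coeff i := hι (hh.trans (coord_orbitSpan_eq hκ hZ hζ i))
    rw [e, ← coeff_map, map_comboPoly hgen hχ hiter, coord_eq_coeff]
  · rw [← hiter, hι (hh.trans (hZ s).symm)]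

/-- Every geometric point of `R` comes from a level structure. -/
theorem exists_generator_of_algHom [IsAlgClosed Ω] (hj : 0 < j) (hjm : j < m) (hg : g ∈ R)
    (hζ : ∀ t, IsGenerator (phiT Fq m j (-1) (g t)) s (ζ t)) (χ : R →ₐ[K] Ω) :
    ∃ z, IsGenerator (phiT Fq m j (-1) (χ ⟨g, hg⟩)) s z ∧
      (∀ (i : ℕ) (h : R),
        (h : T → Ω) = (fun t => coord (orbitSpan (phiT Fq m j (-1) (g t)) (ζ t) : Set Ω) i) →
        χ h = coord (orbitSpan (phiT Fq m j (-1) (χ ⟨g, hg⟩)) z : Set Ω) i) ∧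
      ∀ h : R, (h : T → Ω) = iterFun Fq m j g ζ s →
        χ h = (phiT Fq m j (-1) (χ ⟨g, hg⟩) ^ s) z := by
  have hinj : Function.Injective (algebraMap R (integralClosure R (T → Ω))) := by
    intro a b hab
    have := congrArg (fun x : integralClosure R (T → Ω) => (x : T → Ω)) hab
    exact Subtype.ext this
  -- The iterates of ζ need not lie in R, only in its integral closure among all functions.
  obtain ⟨χ', hχ'⟩ := exists_ringHom_extension (S := integralClosure R (T → Ω)) hinj χ.toRingHom
  let Z : ℕ → integralClosure R (T → Ω) := fun k => ⟨_, isIntegral_iterFun hj hjm hg hζ k⟩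
  let κ : Fq →+* integralClosure R (T → Ω) :=
    (algebraMap R _).comp ((algebraMap K R).comp (algebraMap Fq K))
  obtain ⟨z, hz, h1, h2⟩ := exists_generator_of_ringHom (κ := κ) (Z := Z)
    (ι := (integralClosure R (T → Ω)).val.toRingHom) Subtype.val_injective
    (fun c t => (IsScalarTower.algebraMap_apply Fq K Ω c).symm) (fun i => rfl) hζ
    (g' := algebraMap R _ ⟨g, hg⟩) rfl (W := ⟨_, isIntegral_inv_iterFun hj hjm hg hζ⟩) rfl χ'
    (fun c => (hχ' _).trans ((χ.commutes _).trans (IsScalarTower.algebraMap_apply Fq K Ω c).symm))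
  have eg : χ' (algebraMap R _ ⟨g, hg⟩) = χ ⟨g, hg⟩ := hχ' _
  rw [eg] at hz h1 h2
  exact ⟨z, hz, fun i h hh => (hχ' h).symm.trans (h1 i _ hh),
    fun h hh => (hχ' h).symm.trans (h2 _ hh)⟩

/-- An algebra of functions integral over the polynomials in a single function with infinite
range has Krull dimension one. -/
theorem ringKrullDim_eq_one_of_isIntegral_adjoin [Infinite Ω] (hg : g ∈ R)
    (hsurj : Function.Surjective g) (hR : ∀ f ∈ R, IsIntegral (Algebra.adjoin K {g}) f) :
    ringKrullDim R = 1 := by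
  have hle : Algebra.adjoin K {g} ≤ R := Algebra.adjoin_le (by simpa using hg)
  let := (Subalgebra.inclusion hle).toRingHom.toAlgebra
  have hinj : Function.Injective (algebraMap (Algebra.adjoin K {g}) R) :=
    Subalgebra.inclusion_injective hle
  have : IsScalarTower (Algebra.adjoin K {g}) R (T → Ω) := IsScalarTower.of_algebraMap_eq fun _ => rfl
  have : Algebra.IsIntegral (Algebra.adjoin K {g}) R :=
    ⟨fun f => (isIntegral_algebraMap_iff (B := T → Ω) Subtype.val_injective).1 (hR f.1 f.2)⟩
  rw [ringKrullDim_eq_of_isIntegral hinj]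
  -- A polynomial vanishing at g vanishes on all of Ω, so K[g] is a polynomial ring.
  have hinj' : Function.Injective (aeval g : K[X] →ₐ[K] (T → Ω)) := by
    rw [injective_iff_map_eq_zero]
    intro p hp
    have : p.map (algebraMap K Ω) = 0 := by
      refine Polynomial.funext fun x => ?_
      obtain ⟨t, rfl⟩ := hsurj x
      have h1 := congrFun hp t
      have h2 : (aeval g p) t = aeval (g t) p :=
        (aeval_algHom_apply (Pi.evalAlgHom K (fun _ : T => Ω) t) g p).symm
      rw [h2, Pi.zero_apply, aeval_def, ← eval_map] at h1
      rw [h1, eval_zero]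
    exact (Polynomial.map_eq_zero _).1 this
  have e : K[X] ≃+* Algebra.adjoin K {g} :=
    ((AlgEquiv.ofInjective _ hinj').trans
      (Subalgebra.equivOfEq _ _ (Algebra.adjoin_singleton_eq_range_aeval K g).symm)).toRingEquiv
  rw [← ringKrullDim_eq_of_ringEquiv e]
  exact IsPrincipalIdealRing.ringKrullDim_eq_one _ (Polynomial.not_isField K)

end Integrality

/-! ### Ẍ and Ẋ are affine curves -/

section AffineCurves

variable {Fq : Type u} [Field Fq] [Fintype Fq] {K : Type v} [Field K] [Algebra Fq K]
  {Ω : Type w} [Field Ω] [Algebra Fq Ω] [Algebra K Ω] {m j s : ℕ} {N : Fq[X]}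

variable (Fq K Ω m j N) in
/-- The regular functions on `Ẍ_{m,j}(N)`. -/
def regDD : Subalgebra K (Triple Fq Ω m j N → Ω) := (XDD Fq K Ω m j N).reg

variable (Fq K Ω m j N) in
/-- The regular functions on `Ẋ_{m,j}(N)`. -/
def regD : Subalgebra K (NPair Fq Ω m j N → Ω) := (XD Fq K Ω m j N).reg

variable (Fq K Ω m j N) in
/-- The regular functions of pairs. -/
def regPair : Subalgebra K (Pair Fq Ω m j N → Ω) := (pairSpace Fq K Ω m j N).reg

variable (Fq K Ω m j N) in
/-- The regular functions on `X_{m,j}(N)`. -/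
def reg0 : Subalgebra K (PairClass Fq Ω m j N → Ω) := (X0 Fq K Ω m j N).reg

theorem mem_reg0 {h : PairClass Fq Ω m j N → Ω} :
    h ∈ reg0 Fq K Ω m j N ↔ (fun P => h (Quotient.mk _ P)) ∈ regPair Fq K Ω m j N := Iff.rfl

theorem gj_mem_XDD : (fun P : Triple Fq Ω m j N => P.gj) ∈ regDD Fq K Ω m j N :=
  Algebra.subset_adjoin (Or.inl (Or.inl rfl))

theorem x_mem_XDD : (fun P : Triple Fq Ω m j N => P.x) ∈ regDD Fq K Ω m j N :=
  Algebra.subset_adjoin (Or.inl (Or.inr rfl))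

theorem coord_mem_XDD (i : ℕ) :
    (fun P : Triple Fq Ω m j N => coord (P.G : Set Ω) i) ∈ regDD Fq K Ω m j N :=
  Algebra.subset_adjoin (Or.inr ⟨i, rfl⟩)

theorem gj_mem_XD : (fun P : NPair Fq Ω m j N => P.gj) ∈ regD Fq K Ω m j N :=
  Algebra.subset_adjoin (Or.inl rfl)

theorem coord_mem_XD (i : ℕ) :
    (fun P : NPair Fq Ω m j N => coord (P.G : Set Ω) i) ∈ regD Fq K Ω m j N :=
  Algebra.subset_adjoin (Or.inr ⟨i, rfl⟩)

theorem gm_mem_pairSpace :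
    (fun P : Pair Fq Ω m j N => P.gm) ∈ regPair Fq K Ω m j N :=
  Algebra.subset_adjoin (Or.inl (Or.inl rfl))

theorem inv_gm_mem_pairSpace :
    (fun P : Pair Fq Ω m j N => P.gm⁻¹) ∈ regPair Fq K Ω m j N :=
  Algebra.subset_adjoin (Or.inl (Or.inr (Or.inl rfl)))

theorem gj_mem_pairSpace :
    (fun P : Pair Fq Ω m j N => P.gj) ∈ regPair Fq K Ω m j N :=
  Algebra.subset_adjoin (Or.inl (Or.inr (Or.inr rfl)))

theorem coord_mem_pairSpace (i : ℕ) :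
    (fun P : Pair Fq Ω m j N => coord (P.G : Set Ω) i) ∈ regPair Fq K Ω m j N :=
  Algebra.subset_adjoin (Or.inr ⟨i, rfl⟩)

theorem XDD_adjoin_le {S : Subalgebra K (Triple Fq Ω m j N → Ω)} (h1 : (fun P => P.gj) ∈ S)
    (h2 : (fun P => P.x) ∈ S) (h3 : ∀ i, (fun P => coord (P.G : Set Ω) i) ∈ S) :
    regDD Fq K Ω m j N ≤ S := by
  refine Algebra.adjoin_le ?_
  rintro _ ((rfl | rfl) | ⟨i, rfl⟩)
  exacts [h1, h2, h3 i]

theorem XD_adjoin_le {S : Subalgebra K (NPair Fq Ω m j N → Ω)} (h1 : (fun P => P.gj) ∈ S)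
    (h3 : ∀ i, (fun P => coord (P.G : Set Ω) i) ∈ S) :
    regD Fq K Ω m j N ≤ S := by
  refine Algebra.adjoin_le ?_
  rintro _ (rfl | ⟨i, rfl⟩)
  exacts [h1, h3 i]

theorem pairSpace_adjoin_le {S : Subalgebra K (Pair Fq Ω m j N → Ω)} (h1 : (fun P => P.gm) ∈ S)
    (h2 : (fun P => P.gm⁻¹) ∈ S) (h3 : (fun P => P.gj) ∈ S)
    (h4 : ∀ i, (fun P => coord (P.G : Set Ω) i) ∈ S) :
    regPair Fq K Ω m j N ≤ S := by
  refine Algebra.adjoin_le ?_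
  rintro _ ((rfl | rfl | rfl) | ⟨i, rfl⟩)
  exacts [h1, h2, h3, h4 i]

theorem finite_range_of_eventually_zero {T : Type*} {c : ℕ → T → Ω} {d : ℕ}
    (h : ∀ i, d < i → c i = 0) : (Set.range c).Finite := by
  refine ((Set.finite_Iic d).image c |>.insert 0).subset ?_
  rintro _ ⟨i, rfl⟩
  rcases Nat.lt_or_ge d i with hi | hi
  · exact Or.inl (h i hi)
  · exact Or.inr ⟨i, hi, rfl⟩

theorem XDD_fg : (XDD Fq K Ω m j (X ^ (s + 1))).reg.FG :=
  Subalgebra.fg_def.2 ⟨_, ((Set.finite_singleton _).insert _).union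
    (finite_range_of_eventually_zero fun _ hi =>
      funext fun P => isLevel_coord_eq_zero P.level hi), rfl⟩

theorem XD_fg : (XD Fq K Ω m j (X ^ (s + 1))).reg.FG :=
  Subalgebra.fg_def.2 ⟨_, (Set.finite_singleton _).union
    (finite_range_of_eventually_zero fun _ hi =>
      funext fun P => isLevel_coord_eq_zero P.level hi), rfl⟩

theorem XDD_ev_injective : Function.Injective (XDD Fq K Ω m j (X ^ (s + 1))).ev := by
  intro P P' h
  refine Triple.ext_of_G_of_x (isLevel_ext P.level P'.level fun i => ?_) ?_
  · exact DFunLike.congr_fun h ⟨_, coord_mem_XDD i⟩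
  · exact DFunLike.congr_fun h ⟨_, x_mem_XDD⟩

theorem XD_ev_injective : Function.Injective (XD Fq K Ω m j (X ^ (s + 1))).ev := by
  intro P P' h
  refine NPair.ext ?_ (isLevel_ext P.level P'.level fun i => ?_)
  · exact DFunLike.congr_fun h ⟨_, gj_mem_XD⟩
  · exact DFunLike.congr_fun h ⟨_, coord_mem_XD i⟩

variable [IsScalarTower Fq K Ω] [IsAlgClosed Ω]

theorem regDD_exists_point (hj : 0 < j) (hjm : j < m)
    (χ : regDD Fq K Ω m j (X ^ (s + 1)) →ₐ[K] Ω) :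
    ∃ P : Triple Fq Ω m j (X ^ (s + 1)), ∀ f : regDD Fq K Ω m j (X ^ (s + 1)), χ f = f.1 P := by
  -- An arbitrary choice of generators suffices: the integrality argument takes place in the ring of
  -- all functions.
  choose ζ hζ hG hx using fun P : Triple Fq Ω m j (X ^ (s + 1)) => P.exists_generator
  have hGc : ∀ i, (fun P : Triple Fq Ω m j (X ^ (s + 1)) => coord (P.G : Set Ω) i) =
      fun P => coord (orbitSpan (phiT Fq m j (-1) P.gj) (ζ P) : Set Ω) i := fun i =>
    funext fun P => by rw [← hG P]
  have hxc : (fun P : Triple Fq Ω m j (X ^ (s + 1)) => P.x) =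
      iterFun Fq m j (fun P => P.gj) ζ s := funext fun P => (hx P).symm
  obtain ⟨z, hz, h1, h2⟩ := exists_generator_of_algHom hj hjm gj_mem_XDD hζ χ
  let P : Triple Fq Ω m j (X ^ (s + 1)) := ⟨χ ⟨_, gj_mem_XDD⟩, orbitSpan _ z,
      (phiT Fq m j (-1) (χ ⟨_, gj_mem_XDD⟩) ^ s) z, isLevel_X_pow_iff.2 ⟨z, hz, rfl⟩,
      pow_apply_mem_orbitSpan s, by rw [← Module.End.mul_apply, ← pow_succ', hz.1], hz.2⟩
  have h : χ = (Pi.evalAlgHom K (fun _ => Ω) P).comp (regDD Fq K Ω m j (X ^ (s + 1))).val := by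
    refine AlgHom.adjoin_ext ?_
    rintro _ ((rfl | rfl) | ⟨i, rfl⟩)
    · rfl
    · exact h2 ⟨_, x_mem_XDD⟩ hxc
    · exact h1 i ⟨_, coord_mem_XDD i⟩ (hGc i)
  exact ⟨P, fun f => DFunLike.congr_fun h f⟩

theorem regDD_isIntegral (hj : 0 < j) (hjm : j < m) :
    ∀ f ∈ regDD Fq K Ω m j (X ^ (s + 1)), IsIntegral (Algebra.adjoin K
      {fun P : Triple Fq Ω m j (X ^ (s + 1)) => P.gj}) f := by
  choose ζ hζ hG hx using fun P : Triple Fq Ω m j (X ^ (s + 1)) => P.exists_generator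
  have hGc : ∀ i, (fun P : Triple Fq Ω m j (X ^ (s + 1)) => coord (P.G : Set Ω) i) =
      fun P => coord (orbitSpan (phiT Fq m j (-1) P.gj) (ζ P) : Set Ω) i := fun i =>
    funext fun P => by rw [← hG P]
  have hxc : (fun P : Triple Fq Ω m j (X ^ (s + 1)) => P.x) =
      iterFun Fq m j (fun P => P.gj) ζ s := funext fun P => (hx P).symm
  have hg : (fun P : Triple Fq Ω m j (X ^ (s + 1)) => P.gj) ∈
    Algebra.adjoin K {fun P : Triple Fq Ω m j (X ^ (s + 1)) => P.gj} :=
      Algebra.subset_adjoin rfl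
  have hle : regDD Fq K Ω m j (X ^ (s + 1)) ≤ (integralClosure (Algebra.adjoin K
      {fun P : Triple Fq Ω m j (X ^ (s + 1)) => P.gj}) _).restrictScalars K := by
    refine XDD_adjoin_le (isIntegral_algebraMap (x := (⟨_, hg⟩ : Algebra.adjoin K _))) ?_ fun i => ?_
    · rw [hxc]
      exact isIntegral_iterFun hj hjm hg hζ s
    · rw [hGc]
      exact isIntegral_coord hj hjm hg hζ i
  exact fun f hf => hle hf

theorem XDD_isAffineCurve (hj : 0 < j) (hjm : j < m) :
    (XDD Fq K Ω m j (X ^ (s + 1))).IsAffineCurve := by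
  refine ⟨XDD_fg, ⟨XDD_ev_injective, fun χ => ?_⟩, ?_⟩
  · obtain ⟨P, hP⟩ := regDD_exists_point hj hjm χ
    exact ⟨P, AlgHom.ext fun f => (hP f).symm⟩
  · refine ringKrullDim_eq_one_of_isIntegral_adjoin (R := regDD Fq K Ω m j (X ^ (s + 1)))
      gj_mem_XDD (fun g => ?_) (regDD_isIntegral hj hjm)
    exact Triple.exists_of_gj hj hjm g

theorem regD_exists_point (hj : 0 < j) (hjm : j < m)
    (χ : regD Fq K Ω m j (X ^ (s + 1)) →ₐ[K] Ω) :
    ∃ P : NPair Fq Ω m j (X ^ (s + 1)), ∀ f : regD Fq K Ω m j (X ^ (s + 1)), χ f = f.1 P := by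
  choose ζ hζ hG using fun P : NPair Fq Ω m j (X ^ (s + 1)) => isLevel_X_pow_iff.1 P.level
  have hGc : ∀ i, (fun P : NPair Fq Ω m j (X ^ (s + 1)) => coord (P.G : Set Ω) i) =
      fun P => coord (orbitSpan (phiT Fq m j (-1) P.gj) (ζ P) : Set Ω) i := fun i =>
    funext fun P => by rw [← hG P]
  obtain ⟨z, hz, h1, -⟩ := exists_generator_of_algHom hj hjm gj_mem_XD hζ χ
  let P : NPair Fq Ω m j (X ^ (s + 1)) := ⟨χ ⟨_, gj_mem_XD⟩, orbitSpan _ z,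
    isLevel_X_pow_iff.2 ⟨z, hz, rfl⟩⟩
  have h : χ = (Pi.evalAlgHom K (fun _ => Ω) P).comp (regD Fq K Ω m j (X ^ (s + 1))).val := by
    refine AlgHom.adjoin_ext ?_
    rintro _ (rfl | ⟨i, rfl⟩)
    · rfl
    · exact h1 i ⟨_, coord_mem_XD i⟩ (hGc i)
  exact ⟨P, fun f => DFunLike.congr_fun h f⟩

theorem regD_isIntegral (hj : 0 < j) (hjm : j < m) :
    ∀ f ∈ regD Fq K Ω m j (X ^ (s + 1)), IsIntegral (Algebra.adjoin K
      {fun P : NPair Fq Ω m j (X ^ (s + 1)) => P.gj}) f := by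
  choose ζ hζ hG using fun P : NPair Fq Ω m j (X ^ (s + 1)) => isLevel_X_pow_iff.1 P.level
  have hGc : ∀ i, (fun P : NPair Fq Ω m j (X ^ (s + 1)) => coord (P.G : Set Ω) i) =
      fun P => coord (orbitSpan (phiT Fq m j (-1) P.gj) (ζ P) : Set Ω) i := fun i =>
    funext fun P => by rw [← hG P]
  have hg : (fun P : NPair Fq Ω m j (X ^ (s + 1)) => P.gj) ∈
    Algebra.adjoin K {fun P : NPair Fq Ω m j (X ^ (s + 1)) => P.gj} :=
      Algebra.subset_adjoin rfl
  have hle : regD Fq K Ω m j (X ^ (s + 1)) ≤ (integralClosure (Algebra.adjoin K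
      {fun P : NPair Fq Ω m j (X ^ (s + 1)) => P.gj}) _).restrictScalars K := by
    refine XD_adjoin_le (isIntegral_algebraMap (x := (⟨_, hg⟩ : Algebra.adjoin K _))) fun i => ?_
    · rw [hGc]
      exact isIntegral_coord hj hjm hg hζ i
  exact fun f hf => hle hf

theorem XD_isAffineCurve (hj : 0 < j) (hjm : j < m) :
    (XD Fq K Ω m j (X ^ (s + 1))).IsAffineCurve := by
  refine ⟨XD_fg, ⟨XD_ev_injective, fun χ => ?_⟩, ?_⟩
  · obtain ⟨P, hP⟩ := regD_exists_point hj hjm χ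
    exact ⟨P, AlgHom.ext fun f => (hP f).symm⟩
  · refine ringKrullDim_eq_one_of_isIntegral_adjoin (R := regD Fq K Ω m j (X ^ (s + 1)))
      gj_mem_XD (fun g => ?_) (regD_isIntegral hj hjm)
    obtain ⟨P, hP⟩ := Triple.exists_of_gj (Fq := Fq) (s := s) hj hjm g
    exact ⟨pi1 Fq Ω m j _ P, hP⟩

/-- A regular function on an affine curve without zeros is invertible. -/
theorem KSpace.IsAffineCurve.isUnit {V : KSpace K Ω} (hV : V.IsAffineCurve) (r : V.reg)
    (hr : ∀ p, V.ev p r ≠ 0) : IsUnit r := by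
  have : Algebra.FiniteType K V.reg := V.reg.fg_iff_finiteType.1 hV.fg
  refine isUnit_of_forall_algHom_ne_zero (K := K) (Ω := Ω) r fun χ => ?_
  obtain ⟨p, rfl⟩ := hV.points.2 χ
  exact hr p

end AffineCurves

/-! ### Regularity of x^(q-1) on Ẋ -/

section SocleFunction

variable {Fq : Type u} [Field Fq] [Fintype Fq] {K : Type v} [Field K] [Algebra Fq K]
  {Ω : Type w} [Field Ω] [Algebra Fq Ω] [Algebra K Ω] {m j s : ℕ}

/-- Let H be the orbit of z and H' that of f z. Both f^(k+1) and the polynomial of H' are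
`Fq`-linear on H with kernel H', of index q, so on H they are proportional with nonzero ratio. The
degree of the polynomial of H' is below #H, which makes this multiple the remainder. -/
theorem IsGenerator.modByMonic_levelPoly {f : Module.End Fq Ω} {k : ℕ} {z : Ω}
    (hz : IsGenerator f (k + 1) z) {p : Polynomial Ω} (hp : ∀ v, p.eval v = (f ^ (k + 1)) v) :
    ∃ r ≠ 0, p %ₘ levelPoly (orbitSpan f z : Set Ω) =
      C r * levelPoly (orbitSpan f (f z) : Set Ω) := by
  have hz' : IsGenerator f k (f z) := by
    have := hz.pow_apply (Nat.le_succ k)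
    rwa [Nat.add_sub_cancel_left, pow_one] at this
  have hkill : ∀ w ∈ orbitSpan f (f z), (f ^ (k + 1)) w = 0 := by
    intro w hw
    obtain ⟨a, rfl⟩ := mem_orbitSpan.1 hw
    rw [← aeval_X_pow_mul_apply, aeval_mul_X_pow_apply, hz'.1, map_zero]
  set L := levelPoly (orbitSpan f (f z) : Set Ω)
  have hL : L.eval z ≠ 0 := fun h => hz.2 (hkill z ((eval_levelPoly_eq_zero_iff hz'.finite).1 h))
  refine ⟨(f ^ (k + 1)) z / L.eval z, div_ne_zero hz.2 hL, ?_⟩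
  have hdvd : levelPoly (orbitSpan f z : Set Ω) ∣ p - C ((f ^ (k + 1)) z / L.eval z) * L := by
    refine levelPoly_dvd hz.finite fun v hv => ?_
    obtain ⟨a, rfl⟩ := mem_orbitSpan.1 hv
    -- Modulo H' every element of H is an `Fq`-multiple of z, so comparison at z is enough.
    have hv' : aeval f a z = a.coeff 0 • z + aeval f a.divX (f z) := by
      conv_lhs => rw [← X_mul_divX_add a, ← pow_one X]
      rw [map_add, LinearMap.add_apply, aeval_mul_X_pow_apply, pow_one, add_comm, aeval_C,
        Module.algebraMap_end_apply]
    rw [eval_sub, eval_mul, eval_C, hp, hv', map_add, hkill _ (mem_orbitSpan.2 ⟨_, rfl⟩), add_zero,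
      eval_levelPoly_add hz'.finite (mem_orbitSpan.2 ⟨_, rfl⟩), eval_levelPoly_smul hz'.finite,
      map_smul, mul_smul_comm, div_mul_cancel₀ _ hL, sub_self]
  rw [modByMonic_eq_of_dvd_sub (levelPoly_monic _) hdvd, modByMonic_eq_self_iff (levelPoly_monic _)]
  rw [degree_C_mul (div_ne_zero hz.2 hL), degree_eq_natDegree (levelPoly_monic _).ne_zero,
    degree_eq_natDegree (levelPoly_monic _).ne_zero, natDegree_levelPoly hz.finite,
    natDegree_levelPoly hz'.finite, hz.ncard, hz'.ncard]
  exact_mod_cast card_pow_lt (Nat.lt_succ_self (k + 1))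

/-- The polynomial of the line `Fq` x is Z^q - x^(q-1) Z. -/
theorem IsGenerator.levelPoly_coeff_one {f : Module.End Fq Ω} {x : Ω} (hx : IsGenerator f 0 x) :
    (levelPoly (orbitSpan f x : Set Ω)).coeff 1 = -x ^ (Fintype.card Fq - 1) := by
  have hq : 1 < Fintype.card Fq := Fintype.one_lt_card
  have hmonic : (X ^ Fintype.card Fq - C (x ^ (Fintype.card Fq - 1)) * X : Polynomial Ω).Monic := by
    refine monic_X_pow_sub ?_
    exact (degree_C_mul_X_le _).trans_lt (by exact_mod_cast hq)
  have hdeg : (X ^ Fintype.card Fq - C (x ^ (Fintype.card Fq - 1)) * X : Polynomial Ω).natDegree =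
      Fintype.card Fq := by
    refine natDegree_sub_eq_left_of_natDegree_lt ?_ |>.trans (natDegree_X_pow _)
    rw [natDegree_X_pow]
    exact ((natDegree_C_mul_le _ _).trans natDegree_X_le).trans_lt hq
  have hdvd : levelPoly (orbitSpan f x : Set Ω) ∣
      X ^ Fintype.card Fq - C (x ^ (Fintype.card Fq - 1)) * X := by
    refine levelPoly_dvd hx.finite fun v hv => ?_
    rw [← hx.range_combo] at hv
    obtain ⟨a, rfl⟩ := hv
    have : combo f 0 x a = algebraMap Fq Ω (a 0) * x := by simp [combo, Algebra.smul_def]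
    rw [this, eval_sub, eval_mul, eval_X_pow, eval_X, eval_C, mul_pow, ← map_pow,
      FiniteField.pow_card, mul_left_comm, ← pow_succ, Nat.sub_add_cancel hq.le, sub_self]
  have := eq_of_monic_of_dvd_of_natDegree_le (levelPoly_monic _) hmonic hdvd (by
    rw [hdeg, natDegree_levelPoly hx.finite, hx.ncard]; simp)
  rw [← this, coeff_sub, coeff_C_mul, coeff_X_one, coeff_X_pow, if_neg hq.ne, mul_one, zero_sub]

variable (Fq m j) in
/-- The polynomial inducing the `k`-th iterate of `g_m τ^m + g τ^j + 1`. -/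
def iterPoly {R : Type*} [CommRing R] (gm g : R) : ℕ → Polynomial R
  | 0 => X
  | k + 1 => (phiPoly Fq m j gm g).comp (iterPoly gm g k)

theorem map_iterPoly {R S : Type*} [CommRing R] [CommRing S] (e : R →+* S) (gm g : R) (k : ℕ) :
    (iterPoly Fq m j gm g k).map e = iterPoly Fq m j (e gm) (e g) k := by
  induction k with
  | zero => simp [iterPoly]
  | succ k ih => simp [iterPoly, ih, phiPoly]

theorem eval_iterPoly (gm g v : Ω) (k : ℕ) :
    (iterPoly Fq m j gm g k).eval v = (phiT Fq m j gm g ^ k) v := by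
  induction k with
  | zero => simp [iterPoly]
  | succ k ih => rw [iterPoly, eval_comp, ih, eval_phiPoly, pow_succ', Module.End.mul_apply]

/-- Evaluation of regular functions at a point. -/
def evD (P : NPair Fq Ω m j (X ^ (s + 1))) : regD Fq K Ω m j (X ^ (s + 1)) →+* Ω :=
  (Pi.evalRingHom _ P).comp (regD Fq K Ω m j (X ^ (s + 1))).val.toRingHom

theorem regD_ext {h h' : regD Fq K Ω m j (X ^ (s + 1))} (H : ∀ P, evD P h = evD P h') : h = h' :=
  Subtype.ext (funext H)

theorem monic_of_forall_map_monic {Q : Polynomial (regD Fq K Ω m j (X ^ (s + 1)))} (d : ℕ)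
    (h : ∀ P, (Q.map (evD P)).Monic ∧ (Q.map (evD P)).natDegree = d) : Q.Monic := by
  refine monic_of_natDegree_le_of_coeff_eq_one d (natDegree_le_iff_coeff_eq_zero.2 fun i hi => ?_) ?_
  · refine regD_ext fun P => ?_
    rw [← coeff_map, map_zero]
    exact coeff_eq_zero_of_natDegree_lt ((h P).2 ▸ hi)
  · refine regD_ext fun P => ?_
    rw [← coeff_map, map_one, ← (h P).2]
    exact (h P).1

variable [IsScalarTower Fq K Ω] [IsAlgClosed Ω]

/-- The coefficients of the polynomials of the submodules `G[T^(k+1)]` are regular functions. -/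
theorem exists_polynomial_torsion (hj : 0 < j) (hjm : j < m) {k : ℕ} (hk : k ≤ s) :
    ∃ Q : Polynomial (regD Fq K Ω m j (X ^ (s + 1))), ∀ (P : NPair Fq Ω m j (X ^ (s + 1))) (z : Ω),
      IsGenerator (phiT Fq m j (-1) P.gj) s z → P.G = orbitSpan (phiT Fq m j (-1) P.gj) z →
        Q.map (evD P) = levelPoly (orbitSpan (phiT Fq m j (-1) P.gj)
          ((phiT Fq m j (-1) P.gj ^ (s - k)) z) : Set Ω) := by
  induction hk using Nat.decreasingInduction with
  | self =>
    refine ⟨∑ i ∈ Finset.range (Fintype.card Fq ^ (s + 1) + 1), C ⟨_, coord_mem_XD i⟩ * X ^ i,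
      fun P z hz hG => ?_⟩
    rw [Nat.sub_self, pow_zero, Module.End.one_apply, ← hG,
      (levelPoly (P.G : Set Ω)).as_sum_range_C_mul_X_pow' (n := Fintype.card Fq ^ (s + 1) + 1),
      Polynomial.map_sum]
    · refine Finset.sum_congr rfl fun i _ => ?_
      rw [Polynomial.map_mul, map_C, Polynomial.map_pow, map_X]
      rfl
    · rw [natDegree_levelPoly (isLevel_finite P.level), isLevel_ncard P.level]
      exact Nat.lt_succ_self _
  | of_succ k hk ih =>
    obtain ⟨Q, hQ⟩ := ih
    have hgen : ∀ P : NPair Fq Ω m j (X ^ (s + 1)), ∃ z,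
        IsGenerator (phiT Fq m j (-1) P.gj) (k + 1) z ∧
        Q.map (evD P) = levelPoly (orbitSpan (phiT Fq m j (-1) P.gj) z : Set Ω) := fun P => by
      obtain ⟨z, hz, hG⟩ := isLevel_X_pow_iff.1 P.level
      exact ⟨_, hz.pow_apply hk, hQ P z hz hG⟩
    have hQm : Q.Monic := monic_of_forall_map_monic (Fintype.card Fq ^ (k + 1 + 1)) fun P => by
      obtain ⟨z, hz, hPz⟩ := hgen P
      rw [hPz]
      exact ⟨levelPoly_monic _, by rw [natDegree_levelPoly hz.finite, hz.ncard]⟩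
    set g : regD Fq K Ω m j (X ^ (s + 1)) := ⟨_, gj_mem_XD⟩
    -- Division by the monic Q has coefficients in the regular functions and commutes with
    -- evaluation; at each point the remainder is a nonzero multiple of the polynomial of
    -- G[T^(k+1)].
    set ρ := iterPoly Fq m j (-1) g (k + 1) %ₘ Q
    have hρ : ∀ P z, IsGenerator (phiT Fq m j (-1) P.gj) s z →
        P.G = orbitSpan (phiT Fq m j (-1) P.gj) z → ∃ r ≠ 0, ρ.map (evD P) = C r *
          levelPoly (orbitSpan (phiT Fq m j (-1) P.gj)
            ((phiT Fq m j (-1) P.gj ^ (s - k)) z) : Set Ω) := by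
      intro P z hz hG
      rw [map_modByMonic _ hQm, map_iterPoly, map_neg, map_one, hQ P z hz hG, show s - k = s - (k + 1) + 1 by omega,
        pow_succ' (phiT Fq m j (-1) P.gj), Module.End.mul_apply]
      exact (hz.pow_apply hk).modByMonic_levelPoly fun v => eval_iterPoly _ _ _ _
    set r' := ρ.coeff (Fintype.card Fq ^ (k + 1))
    have hr' : ∀ P z r, IsGenerator (phiT Fq m j (-1) P.gj) s z → ρ.map (evD P) = C r *
          levelPoly (orbitSpan (phiT Fq m j (-1) P.gj)
            ((phiT Fq m j (-1) P.gj ^ (s - k)) z) : Set Ω) → evD P r' = r := by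
      intro P z r hz hr
      have hz' := hz.pow_apply (i := k) hk.le
      rw [← coeff_map, hr, coeff_C_mul, ← hz'.ncard, ← natDegree_levelPoly hz'.finite,
        (levelPoly_monic _).coeff_natDegree, mul_one]
    -- The leading coefficient vanishes at no point of Ẋ, so it can be inverted among regular
    -- functions and the remainder made monic.
    have hunit : IsUnit r' :=
      (XD_isAffineCurve (Fq := Fq) (K := K) (Ω := Ω) (s := s) hj hjm).isUnit r' fun P => by
        obtain ⟨z, hz, hG⟩ := isLevel_X_pow_iff.1 (NPair.level P)
        obtain ⟨r, hr0, hr⟩ := hρ P z hz hG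
        have := hr' P z r hz hr
        exact fun h => hr0 (this.symm.trans h)
    obtain ⟨r'', hr''⟩ := hunit.exists_left_inv
    refine ⟨C r'' * ρ, fun P z hz hG => ?_⟩
    obtain ⟨r, hr0, hr⟩ := hρ P z hz hG
    rw [Polynomial.map_mul, map_C, hr, ← hr' P z r hz hr, ← mul_assoc, ← C_mul, ← map_mul, hr'',
      map_one, C_1, one_mul]

/-- The function `x ^ (q - 1)` is regular on `Ẋ`. -/
theorem exists_socleFunction (hj : 0 < j) (hjm : j < m) :
    ∃ h ∈ regD Fq K Ω m j (X ^ (s + 1)), ∀ P : Triple Fq Ω m j (X ^ (s + 1)),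
      h (pi1 Fq Ω m j _ P) = P.x ^ (Fintype.card Fq - 1) := by
  obtain ⟨Q, hQ⟩ := exists_polynomial_torsion (Fq := Fq) (K := K) (Ω := Ω) (s := s) hj hjm
    (Nat.zero_le s)
  refine ⟨_, (-Q.coeff 1).2, fun P => ?_⟩
  obtain ⟨z, hz, hG, hx⟩ := P.exists_generator
  change evD (pi1 Fq Ω m j _ P) (-Q.coeff 1) = _
  have hz' := hz.pow_apply (Nat.zero_le s)
  rw [Nat.sub_zero, hx] at hz'
  have := hQ (pi1 Fq Ω m j _ P) z hz hG
  rw [map_neg, ← coeff_map, this]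
  change -(levelPoly (orbitSpan (phiT Fq m j (-1) P.gj)
            ((phiT Fq m j (-1) P.gj ^ (s - 0)) z) : Set Ω)).coeff 1 = _
  rw [Nat.sub_zero, hx, hz'.levelPoly_coeff_one, neg_neg]

end SocleFunction

/-! ### Scalings act by automorphisms; invariants of `Fqˣ` -/

section Coverings

variable {Fq : Type u} [Field Fq] [Fintype Fq] {K : Type v} [Field K] [Algebra Fq K]
  {Ω : Type w} [Field Ω] [Algebra Fq Ω] [Algebra K Ω] {m j s : ℕ} {N : Fq[X]}

variable (K Ω) in
/-- Precomposition with a map. -/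
def precomp {T T' : Type*} (a : T → T') : (T' → Ω) →ₐ[K] (T → Ω) where
  toFun h := h ∘ a
  map_one' := rfl
  map_zero' := rfl
  map_add' _ _ := rfl
  map_mul' _ _ := rfl
  commutes' _ := rfl

theorem zpow_mem_of_inv_mem {T : Type*} {R : Subalgebra K (T → Ω)} {u : T → Ω} (h : u ∈ R)
    (h' : u⁻¹ ∈ R) (w : ℤ) : u ^ w ∈ R := by
  cases w with
  | ofNat n => simpa using R.pow_mem h n
  | negSucc n =>
    rw [zpow_negSucc, ← inv_pow]
    exact R.pow_mem h' _

theorem inv_x_mem_XDD (hj : 0 < j) (hjm : j < m) :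
    (fun P : Triple Fq Ω m j N => P.x)⁻¹ ∈ regDD Fq K Ω m j N := by
  have hm1 := one_lt_card_pow (Fq := Fq) (hj.trans hjm)
  have hj1 := one_lt_card_pow (Fq := Fq) hj
  obtain ⟨a, ha⟩ : ∃ a, Fintype.card Fq ^ m = a + 2 := ⟨_, (Nat.sub_add_cancel hm1).symm⟩
  obtain ⟨b, hb⟩ : ∃ b, Fintype.card Fq ^ j = b + 2 := ⟨_, (Nat.sub_add_cancel hj1).symm⟩
  have e : (fun P : Triple Fq Ω m j N => P.x)⁻¹ =
      (fun P => P.x) ^ a - (fun P => P.gj) * (fun P => P.x) ^ b := by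
    funext P
    have h := P.x_ker
    rw [phiT_apply, ha, hb] at h
    refine inv_eq_of_mul_eq_one_right (mul_left_cancel₀ P.x_ne ?_)
    simp only [Pi.sub_apply, Pi.mul_apply, Pi.pow_apply]
    linear_combination -h
  rw [e]
  exact sub_mem (pow_mem x_mem_XDD a) (mul_mem gj_mem_XDD (pow_mem x_mem_XDD b))

theorem comp_toPair_mem {h : Pair Fq Ω m j N → Ω} (hh : h ∈ regPair Fq K Ω m j N) :
    h ∘ NPair.toPair ∈ regD Fq K Ω m j N := by
  have hle : regPair Fq K Ω m j N ≤ (regD Fq K Ω m j N).comap (precomp K Ω NPair.toPair) := by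
    refine pairSpace_adjoin_le ?_ ?_ gj_mem_XD coord_mem_XD
    · have h1 : (-1 : NPair Fq Ω m j N → Ω) ∈ regD Fq K Ω m j N := neg_mem (one_mem _)
      exact h1
    · have h1 : (-1 : NPair Fq Ω m j N → Ω) ∈ regD Fq K Ω m j N := neg_mem (one_mem _)
      have e : precomp K Ω NPair.toPair (fun P : Pair Fq Ω m j N => P.gm⁻¹) = -1 :=
        funext fun P => inv_neg_one
      rw [Subalgebra.mem_comap, e]
      exact h1
  exact hle hh

theorem comp_pi1_mem {h : NPair Fq Ω m j N → Ω} (hh : h ∈ regD Fq K Ω m j N) :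
    h ∘ pi1 Fq Ω m j N ∈ regDD Fq K Ω m j N := by
  have hle : regD Fq K Ω m j N ≤ (regDD Fq K Ω m j N).comap (precomp K Ω (pi1 Fq Ω m j N)) :=
    XD_adjoin_le gj_mem_XDD coord_mem_XDD
  exact hle hh

theorem comp_pi3_mem {h : PairClass Fq Ω m j N → Ω} (hh : h ∈ reg0 Fq K Ω m j N) :
    h ∘ pi3 Fq Ω m j N ∈ regDD Fq K Ω m j N :=
  comp_pi1_mem (comp_toPair_mem (mem_reg0.1 hh))

section Scaling

variable [Infinite Ω] (hj : 0 < j) (hjm : j < m) (hK : Module.finrank Fq K = m) (hm : 0 < m)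

include hj hjm in
theorem scale_gj (μ : Kˣ) (P : Triple Fq Ω m j N) : (scale hK hm μ P).gj =
    algebraMap K Ω μ ^ (1 - ((Fintype.card Fq ^ j : ℕ) : ℤ)) * P.gj :=
  (isIsom_scale hK hm μ P).gj_eq hj hjm (algebraMap_unit_ne_zero μ)

theorem scale_coord (μ : Kˣ) (P : Triple Fq Ω m j (X ^ (s + 1))) (i : ℕ) :
    coord ((scale hK hm μ P).G : Set Ω) i =
      algebraMap K Ω μ ^ (((Fintype.card Fq ^ (s + 1) : ℕ) : ℤ) - i) * coord (P.G : Set Ω) i :=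
  (isIsom_scale hK hm μ P).coord_eq (algebraMap_unit_ne_zero μ) i

theorem mem_of_eq_algebraMap_mul {T : Type*} {R : Subalgebra K (T → Ω)} {h h' : T → Ω} (a : K)
    (hh : h ∈ R) (e : ∀ t, h' t = algebraMap K Ω a * h t) : h' ∈ R := by
  have : h' = a • h := funext fun t => by rw [e, Pi.smul_apply, Algebra.smul_def]
  rw [this]
  exact R.smul_mem hh a

include hj hjm in
theorem comp_scale_mem (μ : Kˣ) {f : Triple Fq Ω m j (X ^ (s + 1)) → Ω}
    (hf : f ∈ regDD Fq K Ω m j (X ^ (s + 1))) :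
    f ∘ scale hK hm μ ∈ regDD Fq K Ω m j (X ^ (s + 1)) := by
  have hle : regDD Fq K Ω m j (X ^ (s + 1)) ≤
      (regDD Fq K Ω m j (X ^ (s + 1))).comap (precomp K Ω (scale hK hm μ)) := by
    refine XDD_adjoin_le ?_ ?_ fun i => ?_ <;> rw [Subalgebra.mem_comap]
    · refine mem_of_eq_algebraMap_mul (h := fun P => P.gj)
        ((μ : K) ^ (1 - ((Fintype.card Fq ^ j : ℕ) : ℤ))) gj_mem_XDD fun P => ?_
      rw [map_zpow₀]
      exact scale_gj hj hjm hK hm μ P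
    · exact mem_of_eq_algebraMap_mul (h := fun P => P.x) (μ : K) x_mem_XDD fun P => rfl
    · refine mem_of_eq_algebraMap_mul (h := fun P => coord (P.G : Set Ω) i)
        ((μ : K) ^ (((Fintype.card Fq ^ (s + 1) : ℕ) : ℤ) - i))
        (coord_mem_XDD i) fun P => ?_
      rw [map_zpow₀]
      exact scale_coord hK hm μ P i
  exact hle hf

/-- Among the generators of the functions of Ẍ only x is not pulled back from Ẋ. -/
theorem exists_polynomial_in_x {f : Triple Fq Ω m j N → Ω} (hf : f ∈ regDD Fq K Ω m j N) :
    ∃ p : Polynomial (NPair Fq Ω m j N → Ω), (∀ i, p.coeff i ∈ regD Fq K Ω m j N) ∧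
      ∀ P, f P = ∑ i ∈ p.support, p.coeff i (pi1 Fq Ω m j N P) * P.x ^ i := by
  let φ : regD Fq K Ω m j N →+* (Triple Fq Ω m j N → Ω) :=
    ((precomp K Ω (pi1 Fq Ω m j N)).comp (regD Fq K Ω m j N).val).toRingHom
  let Θ : Polynomial (regD Fq K Ω m j N) →+* (Triple Fq Ω m j N → Ω) :=
    eval₂RingHom φ (fun P => P.x)
  have hC : ∀ h : regD Fq K Ω m j N, Θ (C h) = h.1 ∘ pi1 Fq Ω m j N := fun h =>
    eval₂_C _ _
  let S : Subalgebra K (Triple Fq Ω m j N → Ω) :=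
    { Θ.range with
      algebraMap_mem' := fun c => ⟨C (algebraMap K (regD Fq K Ω m j N) c), hC _⟩ }
  have hle : regDD Fq K Ω m j N ≤ S := by
    refine XDD_adjoin_le ?_ ?_ fun i => ?_
    · exact ⟨C ⟨_, gj_mem_XD⟩, hC _⟩
    · exact ⟨X, eval₂_X _ _⟩
    · exact ⟨C ⟨_, coord_mem_XD i⟩, hC _⟩
  obtain ⟨p, rfl⟩ := hle hf
  let ι : regD Fq K Ω m j N →+* (NPair Fq Ω m j N → Ω) := (regD Fq K Ω m j N).val.toRingHom
  have hinj : Function.Injective ι := Subtype.val_injective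
  refine ⟨p.map ι, fun i => ?_, fun P => ?_⟩
  · rw [coeff_map]
    exact (p.coeff i).2
  · rw [support_map_of_injective _ hinj]
    change (p.eval₂ φ (fun P => P.x)) P = _
    rw [eval₂_eq_sum, Polynomial.sum, Finset.sum_apply]
    refine Finset.sum_congr rfl fun i _ => ?_
    rw [coeff_map]
    rfl

variable [IsScalarTower Fq K Ω]

include hj hjm in
-- Summing f over `Fqˣ` multiplies the coefficient of x^i by ∑ μ^i, which is -1 if q - 1 divides i
-- and 0 otherwise. The sum itself is (q - 1) f = -f, so only powers of x^(q-1) remain.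
theorem exists_of_fq_invariant [IsAlgClosed Ω] {f : Triple Fq Ω m j (X ^ (s + 1)) → Ω}
    (hf : f ∈ regDD Fq K Ω m j (X ^ (s + 1)))
    (hinv : ∀ μ : Fqˣ, f ∘ scale hK hm (Units.map (algebraMap Fq K : Fq →* K) μ) = f) :
    ∃ h ∈ regD Fq K Ω m j (X ^ (s + 1)), f = h ∘ pi1 Fq Ω m j _ := by
  classical
  obtain ⟨p, hp, hfp⟩ := exists_polynomial_in_x hf
  obtain ⟨u, hu, hux⟩ := exists_socleFunction (Fq := Fq) (K := K) (Ω := Ω) (s := s) hj hjm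
  refine ⟨∑ i ∈ p.support with Fintype.card Fq - 1 ∣ i,
    p.coeff i * u ^ (i / (Fintype.card Fq - 1)),
    sum_mem fun i _ => mul_mem (hp i) (pow_mem hu _), funext fun P => ?_⟩
  have hscale : ∀ μ : Fqˣ, f P = ∑ i ∈ p.support,
      p.coeff i (pi1 Fq Ω m j _ P) * P.x ^ i * algebraMap Fq Ω ((μ : Fq) ^ i) := by
    intro μ
    conv_lhs => rw [← hinv μ]
    rw [Function.comp_apply, hfp, pi1_scale_fq hj hjm]
    refine Finset.sum_congr rfl fun i _ => ?_
    have e : (scale hK hm (Units.map (algebraMap Fq K : Fq →* K) μ) P).x =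
        algebraMap Fq Ω μ * P.x := by
      change algebraMap K Ω (algebraMap Fq K μ) * P.x = _
      rw [← IsScalarTower.algebraMap_apply]
    rw [e, mul_pow, map_pow]
    ring
  have hsum : ∑ _μ : Fqˣ, f P = ∑ i ∈ p.support, p.coeff i (pi1 Fq Ω m j _ P) * P.x ^ i *
      algebraMap Fq Ω (∑ μ : Fqˣ, (μ : Fq) ^ i) := by
    rw [Finset.sum_congr rfl fun μ _ => hscale μ, Finset.sum_comm]
    refine Finset.sum_congr rfl fun i _ => ?_
    rw [map_sum, Finset.mul_sum]
  have hq : ((Fintype.card Fq : ℕ) : Ω) = 0 := by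
    rw [← map_natCast (algebraMap Fq Ω), FiniteField.cast_card_eq_zero, map_zero]
  have hcard : ∑ _μ : Fqˣ, f P = -f P := by
    rw [Finset.sum_const, Finset.card_univ, Fintype.card_units, nsmul_eq_mul,
      Nat.cast_sub Fintype.card_pos, hq]
    simp
  rw [hcard] at hsum
  rw [← neg_neg (f P), hsum, ← Finset.sum_neg_distrib, Function.comp_apply, Finset.sum_apply,
    Finset.sum_filter]
  refine Finset.sum_congr rfl fun i _ => ?_
  rw [FiniteField.sum_pow_units]
  split_ifs with hi
  · rw [Pi.mul_apply, Pi.pow_apply, hux, ← pow_mul, Nat.mul_div_cancel' hi]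
    simp
  · simp

theorem pi1_isGaloisCovering [IsAlgClosed Ω] (hj : 0 < j) (hjm : j < m) :
    IsGaloisCovering (Y := XDD Fq K Ω m j (X ^ (s + 1))) (X := XD Fq K Ω m j (X ^ (s + 1)))
      (pi1 Fq Ω m j (X ^ (s + 1)))
      ((scaleHom Fq Ω m j (X ^ (s + 1)) K hK hm).comp
        (Units.map (algebraMap Fq K : Fq →* K))) where
  morphism _ h := comp_pi1_mem h
  automorphism _ _ h := comp_scale_mem hj hjm hK hm _ h
  surjective := pi1_surjective
  fibre y y' := pi1_fibre hj hjm hK hm y y'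
  invariant _ hf hinv := exists_of_fq_invariant hj hjm hK hm hf hinv

end Scaling

end Coverings

/-! ### Homogeneous functions, invariants of `Kˣ`, and the curve X -/

section Quotient

variable {Fq : Type u} [Field Fq] [Fintype Fq] {K : Type v} [Field K] [Algebra Fq K]
  {Ω : Type w} [Field Ω] [Algebra Fq Ω] [Algebra K Ω] {m j s : ℕ} {N : Fq[X]}

/-- `F` has weight `w` under isomorphisms of pairs. -/
def IsHomogeneous (F : Pair Fq Ω m j N → Ω) (w : ℤ) : Prop :=
  ∀ ⦃c : Ω⦄, c ≠ 0 → ∀ ⦃P P'⦄, IsIsom c P P' → F P' = c ^ w * F P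

theorem IsHomogeneous.mul {F F' : Pair Fq Ω m j N → Ω} {w w' : ℤ} (h : IsHomogeneous F w)
    (h' : IsHomogeneous F' w') : IsHomogeneous (F * F') (w + w') := by
  intro c hc P P' hP
  rw [Pi.mul_apply, Pi.mul_apply, h hc hP, h' hc hP, zpow_add₀ hc]
  ring

theorem isHomogeneous_one : IsHomogeneous (1 : Pair Fq Ω m j N → Ω) 0 := by
  intro c _ P P' _
  simp

theorem IsHomogeneous.inv {F : Pair Fq Ω m j N → Ω} {w : ℤ} (h : IsHomogeneous F w) :
    IsHomogeneous (fun P => (F P)⁻¹) (-w) := by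
  intro c hc P P' hP
  change (F P')⁻¹ = c ^ (-w) * (F P)⁻¹
  rw [h hc hP, mul_inv, zpow_neg]

theorem isHomogeneous_gm [Infinite Ω] (hj : 0 < j) (hjm : j < m) :
    IsHomogeneous (fun P : Pair Fq Ω m j N => P.gm) (1 - ((Fintype.card Fq ^ m : ℕ) : ℤ)) :=
  fun _ hc _ _ hP => hP.gm_eq hj hjm hc

theorem isHomogeneous_gj [Infinite Ω] (hj : 0 < j) (hjm : j < m) :
    IsHomogeneous (fun P : Pair Fq Ω m j N => P.gj) (1 - ((Fintype.card Fq ^ j : ℕ) : ℤ)) :=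
  fun _ hc _ _ hP => hP.gj_eq hj hjm hc

theorem isHomogeneous_coord (i : ℕ) :
    IsHomogeneous (fun P : Pair Fq Ω m j (X ^ (s + 1)) => coord (P.G : Set Ω) i)
      (((Fintype.card Fq ^ (s + 1) : ℕ) : ℤ) - i) :=
  fun _ hc _ _ hP => hP.coord_eq hc i

variable (Fq K Ω m j N) in
/-- The monoid of homogeneous regular functions of pairs. -/
def homogeneousSubmonoid : Submonoid (Pair Fq Ω m j N → Ω) where
  carrier := {F | F ∈ regPair Fq K Ω m j N ∧ ∃ w, IsHomogeneous F w}
  one_mem' := ⟨one_mem _, 0, isHomogeneous_one⟩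
  mul_mem' := by
    rintro F F' ⟨h, w, hw⟩ ⟨h', w', hw'⟩
    exact ⟨mul_mem h h', _, hw.mul hw'⟩

/-- The generators are homogeneous, hence so are the monomials, which span. -/
theorem regPair_le_span [Infinite Ω] (hj : 0 < j) (hjm : j < m) :
    Subalgebra.toSubmodule (regPair Fq K Ω m j (X ^ (s + 1))) ≤
      Submodule.span K (homogeneousSubmonoid Fq K Ω m j (X ^ (s + 1)) : Set _) := by
  refine (Algebra.adjoin_eq_span K _).le.trans (Submodule.span_mono ?_)
  refine SetLike.coe_subset_coe.2 (Submonoid.closure_le.2 ?_)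
  rintro _ ((rfl | rfl | rfl) | ⟨i, rfl⟩)
  · exact ⟨gm_mem_pairSpace, _, isHomogeneous_gm hj hjm⟩
  · exact ⟨inv_gm_mem_pairSpace, _, (isHomogeneous_gm hj hjm).inv⟩
  · exact ⟨gj_mem_pairSpace, _, isHomogeneous_gj hj hjm⟩
  · exact ⟨coord_mem_pairSpace i, _, isHomogeneous_coord i⟩

theorem exists_pair_function {h : NPair Fq Ω m j N → Ω} (hh : h ∈ regD Fq K Ω m j N) :
    ∃ F ∈ regPair Fq K Ω m j N, F ∘ NPair.toPair = h := by
  have hle : regD Fq K Ω m j N ≤ (regPair Fq K Ω m j N).map (precomp K Ω NPair.toPair) :=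
    XD_adjoin_le ⟨_, gj_mem_pairSpace, rfl⟩ fun i => ⟨_, coord_mem_pairSpace i, rfl⟩
  exact hle hh

theorem exists_eq_of_isHomogeneous_zero {F : Pair Fq Ω m j N → Ω}
    (hF : F ∈ regPair Fq K Ω m j N) (h : IsHomogeneous F 0) :
    ∃ k ∈ reg0 Fq K Ω m j N, ∀ P, k (Quotient.mk _ P) = F P := by
  refine ⟨Quotient.lift F ?_, mem_reg0.2 hF, fun P => rfl⟩
  rintro P P' ⟨c, hc, hP⟩
  rw [h hc hP, zpow_zero, one_mul]

theorem isHomogeneous_neg_gm_zpow [Infinite Ω] (hj : 0 < j) (hjm : j < m) (e : ℤ) :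
    IsHomogeneous (fun P : Pair Fq Ω m j N => (-P.gm) ^ e)
      ((1 - ((Fintype.card Fq ^ m : ℕ) : ℤ)) * e) := by
  intro c hc P P' hP
  change (-P'.gm) ^ e = _ * (-P.gm) ^ e
  rw [hP.gm_eq hj hjm hc, ← mul_neg, mul_zpow, zpow_mul]

theorem neg_gm_zpow_mem (e : ℤ) :
    (fun P : Pair Fq Ω m j N => (-P.gm) ^ e) ∈ regPair Fq K Ω m j N := by
  refine zpow_mem_of_inv_mem (u := fun P : Pair Fq Ω m j N => -P.gm)
    (neg_mem gm_mem_pairSpace) ?_ e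
  have e : (fun P : Pair Fq Ω m j N => -P.gm)⁻¹ = -fun P => P.gm⁻¹ :=
    funext fun P => inv_neg
  rw [e]
  exact neg_mem inv_gm_mem_pairSpace

variable [Infinite Ω] (hj : 0 < j) (hjm : j < m) (hK : Module.finrank Fq K = m) (hm : 0 < m)

include hj hjm in
-- The sum is ∑ μ^w times F. If μ ↦ μ^w is a nontrivial character it vanishes; otherwise q^m - 1
-- divides w, and a power of -g_m, of weight 1 - q^m, turns F into a function of the class without
-- changing it on normalized pairs.
theorem exists_sum_scale_of_isHomogeneous [Fintype K] [DecidableEq K]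
    {F : Pair Fq Ω m j N → Ω} {w : ℤ}
    (hF : F ∈ regPair Fq K Ω m j N) (hw : IsHomogeneous F w) :
    ∃ k ∈ reg0 Fq K Ω m j N, ∀ y : Triple Fq Ω m j N,
      ∑ μ : Kˣ, F (pi1 Fq Ω m j N (scale hK hm μ y)).toPair = k (pi3 Fq Ω m j N y) := by
  let χ : Kˣ →* Ω :=
    ((algebraMap K Ω : K →* Ω).comp (Units.coeHom K)).comp (zpowGroupHom w)
  have hχ : ∀ (μ : Kˣ) (y : Triple Fq Ω m j N),
      F (pi1 Fq Ω m j N (scale hK hm μ y)).toPair = χ μ * F (pi1 Fq Ω m j N y).toPair := by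
    intro μ y
    rw [hw (algebraMap_unit_ne_zero μ) (isIsom_scale hK hm μ y)]
    simp [χ]
  by_cases h1 : χ = 1
  · have hcard : Fintype.card K = Fintype.card Fq ^ m := by
      rw [Module.card_eq_pow_finrank (K := Fq), hK]
    obtain ⟨g, hg⟩ := IsCyclic.exists_generator (α := Kˣ)
    have hgw : g ^ w = 1 := by
      have := DFunLike.congr_fun h1 g
      refine Units.ext ((algebraMap K Ω).injective ?_)
      simpa [χ] using this
    have hdvd := orderOf_dvd_iff_zpow_eq_one.2 hgw
    rw [orderOf_eq_card_of_forall_mem_zpowers hg, Nat.card_eq_fintype_card, Fintype.card_units,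
      hcard, Nat.cast_sub (one_lt_card_pow (Fq := Fq) hm).le] at hdvd
    obtain ⟨e, rfl⟩ := hdvd
    have hF0 : IsHomogeneous (F * fun P => (-P.gm) ^ e) 0 := by
      convert hw.mul (isHomogeneous_neg_gm_zpow hj hjm e) using 1
      push_cast
      ring
    obtain ⟨k, hk, hkF⟩ := exists_eq_of_isHomogeneous_zero
      (mul_mem hF (neg_gm_zpow_mem e)) hF0
    -- There are q^m - 1 summands, and q^m = 0 in Ω, which explains the sign.
    refine ⟨-k, neg_mem hk, fun y => ?_⟩
    have hK0 : ((Fintype.card K : ℕ) : Ω) = 0 := by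
      rw [← map_natCast (algebraMap K Ω), FiniteField.cast_card_eq_zero, map_zero]
    have h2 : k (pi3 Fq Ω m j N y) = F (pi1 Fq Ω m j N y).toPair := by
      refine (hkF _).trans ?_
      simp [NPair.toPair]
    rw [Finset.sum_congr rfl fun μ _ => hχ μ y, h1, Pi.neg_apply, h2]
    simp [Fintype.card_units, Nat.cast_sub Fintype.card_pos, hK0]
  · refine ⟨0, zero_mem _, fun y => ?_⟩
    rw [Finset.sum_congr rfl fun μ _ => hχ μ y, ← Finset.sum_mul, sum_hom_units_eq_zero χ h1,
      zero_mul, Pi.zero_apply]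

include hj hjm in
theorem exists_sum_scale [Fintype K] [DecidableEq K] {F : Pair Fq Ω m j (X ^ (s + 1)) → Ω}
    (hF : F ∈ regPair Fq K Ω m j (X ^ (s + 1))) :
    ∃ k ∈ reg0 Fq K Ω m j (X ^ (s + 1)), ∀ y : Triple Fq Ω m j (X ^ (s + 1)),
      ∑ μ : Kˣ, F (pi1 Fq Ω m j _ (scale hK hm μ y)).toPair = k (pi3 Fq Ω m j _ y) := by
  have hF' := regPair_le_span hj hjm hF
  clear hF
  induction hF' using Submodule.span_induction with
  | mem F h =>
    obtain ⟨h1, w, hw⟩ := h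
    exact exists_sum_scale_of_isHomogeneous hj hjm hK hm h1 hw
  | zero => exact ⟨0, zero_mem _, by simp⟩
  | add F F' _ _ h h' =>
    obtain ⟨k, hk, hkF⟩ := h
    obtain ⟨k', hk', hkF'⟩ := h'
    refine ⟨k + k', add_mem hk hk', fun y => ?_⟩
    simp only [Pi.add_apply, Finset.sum_add_distrib, hkF, hkF']
  | smul a F _ h =>
    obtain ⟨k, hk, hkF⟩ := h
    refine ⟨a • k, Subalgebra.smul_mem _ hk a, fun y => ?_⟩
    simp only [Pi.smul_apply, ← Finset.smul_sum, hkF]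

variable [IsScalarTower Fq K Ω] [IsAlgClosed Ω]

include hj hjm in
-- Invariance under `Fqˣ` brings f down to Ẋ, where it extends to a regular function of pairs. Its
-- sum over `Kˣ` is a function of the class, and by invariance equals (q^m - 1) f = -f.
theorem exists_of_invariant {f : Triple Fq Ω m j (X ^ (s + 1)) → Ω}
    (hf : f ∈ regDD Fq K Ω m j (X ^ (s + 1))) (hinv : ∀ μ : Kˣ, f ∘ scale hK hm μ = f) :
    ∃ h ∈ reg0 Fq K Ω m j (X ^ (s + 1)), f = h ∘ pi3 Fq Ω m j _ := by
  classical
  have hfin : Module.Finite Fq K := Module.finite_of_finrank_pos (hK ▸ hm)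
  have hfin' : Finite K := Module.finite_of_finite Fq
  have := Fintype.ofFinite K
  obtain ⟨h, hh, rfl⟩ := exists_of_fq_invariant hj hjm hK hm hf fun μ => hinv _
  obtain ⟨F, hF, rfl⟩ := exists_pair_function hh
  obtain ⟨k, hk, hkF⟩ := exists_sum_scale hj hjm hK hm hF
  refine ⟨-k, neg_mem hk, funext fun y => ?_⟩
  have hK0 : ((Fintype.card K : ℕ) : Ω) = 0 := by
    rw [← map_natCast (algebraMap K Ω), FiniteField.cast_card_eq_zero, map_zero]
  have hμ : ∀ μ : Kˣ, F (pi1 Fq Ω m j _ (scale hK hm μ y)).toPair =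
      F (pi1 Fq Ω m j _ y).toPair := fun μ => congrFun (hinv μ) y
  have e := hkF y
  rw [Finset.sum_congr rfl fun μ _ => hμ μ, Finset.sum_const, Finset.card_univ,
    Fintype.card_units, nsmul_eq_mul, Nat.cast_sub Fintype.card_pos, hK0] at e
  rw [Function.comp_apply (f := -k), Pi.neg_apply, ← e]
  simp

theorem pi3_isGaloisCovering (hj : 0 < j) (hjm : j < m) :
    IsGaloisCovering (Y := XDD Fq K Ω m j (X ^ (s + 1))) (X := X0 Fq K Ω m j (X ^ (s + 1)))
      (pi3 Fq Ω m j (X ^ (s + 1))) (scaleHom Fq Ω m j (X ^ (s + 1)) K hK hm) where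
  morphism _ h := comp_pi3_mem h
  automorphism _ _ h := comp_scale_mem hj hjm hK hm _ h
  surjective := pi3_surjective hj hjm
  fibre y y' := pi3_fibre hj hjm hK hm y y'
  invariant _ hf hinv := exists_of_invariant hj hjm hK hm hf hinv

omit [IsScalarTower Fq K Ω] [IsAlgClosed Ω] in
include hj hjm in
/-- The class of `(φ, G)` contains the pair `(x⁻¹ φ x, x⁻¹ G)`. -/
theorem Triple.exists_model (y : Triple Fq Ω m j N) :
    ∃ P : Pair Fq Ω m j N, IsIsom y.x⁻¹ (pi1 Fq Ω m j N y).toPair P := by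
  have hc : y.x⁻¹ ≠ 0 := inv_ne_zero y.x_ne
  have h : scalar Fq y.x⁻¹ * phiT Fq m j (-1) y.gj =
      phiT Fq m j (y.x⁻¹ * (-1) / y.x⁻¹ ^ Fintype.card Fq ^ m)
        (y.x⁻¹ * y.gj / y.x⁻¹ ^ Fintype.card Fq ^ j) * scalar Fq y.x⁻¹ :=
    (scalar_mul_phiT_iff hj hjm).2
      ⟨div_mul_cancel₀ _ (pow_ne_zero _ hc), div_mul_cancel₀ _ (pow_ne_zero _ hc)⟩
  exact ⟨⟨_, _, y.G.map (scalar Fq y.x⁻¹), div_ne_zero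
    (mul_ne_zero hc (neg_ne_zero.2 one_ne_zero)) (pow_ne_zero _ hc), y.level.map hc h⟩, h, rfl⟩

/-- The pair `(x⁻¹ φ x, x⁻¹ G)` isomorphic to `(φ, G)`. -/
def Triple.model (y : Triple Fq Ω m j N) : Pair Fq Ω m j N := (y.exists_model hj hjm).choose

theorem Triple.isIsom_model (y : Triple Fq Ω m j N) :
    IsIsom y.x⁻¹ (pi1 Fq Ω m j N y).toPair (y.model hj hjm) :=
  (y.exists_model hj hjm).choose_spec

theorem Triple.mk_model (y : Triple Fq Ω m j N) :
    Quotient.mk _ (y.model hj hjm) = pi3 Fq Ω m j N y :=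
  (Quotient.sound (s := pairSetoid Fq Ω m j N)
    ⟨_, inv_ne_zero y.x_ne, y.isIsom_model hj hjm⟩).symm

/-- On the model `(x⁻¹ φ x, x⁻¹ G)` homogeneous functions are functions of the class. -/
theorem IsHomogeneous.exists_comp_model (hK : Module.finrank Fq K = m)
    {F : Pair Fq Ω m j (X ^ (s + 1)) → Ω} {w : ℤ}
    (hw : IsHomogeneous F w) (hF : F ∈ regPair Fq K Ω m j (X ^ (s + 1))) :
    ∃ k ∈ reg0 Fq K Ω m j (X ^ (s + 1)), ∀ y : Triple Fq Ω m j (X ^ (s + 1)),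
      F (y.model hj hjm) = k (pi3 Fq Ω m j _ y) := by
  have hm : 0 < m := hj.trans hjm
  have e : ∀ y : Triple Fq Ω m j (X ^ (s + 1)),
      F (y.model hj hjm) = y.x⁻¹ ^ w * F (pi1 Fq Ω m j _ y).toPair := fun y =>
    hw (inv_ne_zero y.x_ne) (y.isIsom_model hj hjm)
  have hmem : (fun y => F (y.model hj hjm)) ∈ regDD Fq K Ω m j (X ^ (s + 1)) := by
    rw [funext e]
    refine mul_mem (zpow_mem_of_inv_mem (inv_x_mem_XDD hj hjm) ?_ w)
      (comp_pi1_mem (comp_toPair_mem hF))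
    rw [inv_inv]
    exact x_mem_XDD
  -- The factor μ^w from F cancels μ^(-w) from x^(-w).
  have hinv : ∀ μ : Kˣ,
      (fun y : Triple Fq Ω m j (X ^ (s + 1)) => F (y.model hj hjm)) ∘ scale hK hm μ =
        fun y => F (y.model hj hjm) := by
    intro μ
    funext y
    rw [Function.comp_apply, e, e,
      hw (algebraMap_unit_ne_zero μ) (isIsom_scale hK hm μ y), ← mul_assoc, ← mul_zpow]
    congr 2
    change (algebraMap K Ω μ * y.x)⁻¹ * _ = _
    rw [mul_inv, mul_right_comm, inv_mul_cancel₀ (algebraMap_unit_ne_zero μ), one_mul]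
  obtain ⟨k, hk, hkF⟩ := exists_of_invariant hj hjm hK hm hmem hinv
  exact ⟨k, hk, congrFun hkF⟩

include hj hjm in
-- All coordinates of the model are regular on X, so points not separated by regular functions have
-- the same model and hence the same class.
theorem X0_ev_injective (hK : Module.finrank Fq K = m) :
    Function.Injective (X0 Fq K Ω m j (X ^ (s + 1))).ev := by
  intro c c' h
  obtain ⟨y, rfl⟩ := pi3_surjective hj hjm c
  obtain ⟨y', rfl⟩ := pi3_surjective hj hjm c'
  have H : ∀ k ∈ reg0 Fq K Ω m j (X ^ (s + 1)), k (pi3 Fq Ω m j _ y) = k (pi3 Fq Ω m j _ y') :=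
    fun k hk => DFunLike.congr_fun h ⟨k, hk⟩
  have H' : ∀ (F : Pair Fq Ω m j (X ^ (s + 1)) → Ω) (w : ℤ), IsHomogeneous F w →
      F ∈ regPair Fq K Ω m j (X ^ (s + 1)) → F (y.model hj hjm) = F (y'.model hj hjm) := by
    intro F w hw hF
    obtain ⟨k, hk, e⟩ := hw.exists_comp_model hj hjm hK hF
    rw [e, e, H k hk]
  have hP : y.model hj hjm = y'.model hj hjm :=
    Pair.ext (H' (fun P => P.gm) _ (isHomogeneous_gm hj hjm) gm_mem_pairSpace)
      (H' (fun P => P.gj) _ (isHomogeneous_gj hj hjm) gj_mem_pairSpace)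
      (isLevel_ext (y.model hj hjm).level (y'.model hj hjm).level fun i =>
        H' (fun P => coord (P.G : Set Ω) i) _ (isHomogeneous_coord i) (coord_mem_pairSpace i))
  rw [← y.mk_model hj hjm, ← y'.mk_model hj hjm, hP]

theorem X0_isAffineCurve (hj : 0 < j) (hjm : j < m) (hK : Module.finrank Fq K = m) :
    (X0 Fq K Ω m j (X ^ (s + 1))).IsAffineCurve := by
  have hm : 0 < m := hj.trans hjm
  have hfin : Module.Finite Fq K := Module.finite_of_finrank_pos (hK ▸ hm)
  have hfin' : Finite K := Module.finite_of_finite Fq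
  exact (pi3_isGaloisCovering hK hm hj hjm).isAffineCurve (XDD_isAffineCurve hj hjm)
    (X0_ev_injective hj hjm hK)

end Quotient

/-! ### Points rational over L -/

section Rationality

theorem levelPoly_image {L Ω : Type*} [Field L] [Field Ω] [Algebra L Ω] {S : Set Ω}
    (hS : S.Finite) (ξ : Ω ≃ₐ[L] Ω) :
    levelPoly (ξ '' S) = (levelPoly S).map (ξ : Ω →+* Ω) := by
  classical
  have e : (hS.image ξ).toFinset = hS.toFinset.image ξ := by ext; simp
  rw [levelPoly_eq_prod (hS.image ξ), levelPoly_eq_prod hS, Polynomial.map_prod, e, Finset.prod_image fun _ _ _ _ h => ξ.injective h]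
  simp

theorem isSeparable_coord {L Ω : Type*} [Field L] [Field Ω] [Algebra L Ω] {S : Set Ω}
    (hS : S.Finite) (hsep : ∀ v ∈ S, IsSeparable L v) (i : ℕ) : IsSeparable L (coord S i) := by
  classical
  have h : levelPoly S ∈ lifts (algebraMap (separableClosure L Ω) Ω) := by
    rw [levelPoly_eq_prod hS]
    refine prod_mem fun v hv => ?_
    exact ⟨X - C ⟨v, mem_separableClosure_iff.2 (hsep v (hS.mem_toFinset.1 hv))⟩, by simp⟩
  obtain ⟨y, hy⟩ := (lifts_iff_coeff_lifts _).1 h i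
  rw [coord_eq_coeff, ← hy]
  exact mem_separableClosure_iff.1 y.2

variable {Fq : Type u} [Field Fq] [Fintype Fq] {K : Type v} [Field K] [Algebra Fq K]
  {L : Type*} [Field L] [Algebra K L]
  {Ω : Type w} [Field Ω] [Algebra L Ω] [Algebra Fq Ω] [Algebra K Ω] [IsScalarTower Fq K Ω]
  [IsScalarTower K L Ω] {m j s : ℕ} {N : Fq[X]}

/-- Stability means that the coefficients of ∏(Z - v) are fixed by Aut(Ω/L). Separability is what
places fixed elements in L itself rather than in a purely inseparable extension. -/
theorem isStable_iff [Normal L Ω] {G : Submodule Fq Ω} (hG : (G : Set Ω).Finite)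
    (hsep : ∀ v ∈ G, IsSeparable L v) :
    IsStable L G ↔ ∀ i, coord (G : Set Ω) i ∈ (algebraMap L Ω).range := by
  constructor
  · intro h i
    refine mem_range_of_isSeparable_of_fixed (isSeparable_coord hG hsep i) fun ξ => ?_
    have := congrArg (fun p => p.coeff i) (levelPoly_image hG ξ)
    rw [h ξ] at this
    simp only [coeff_map] at this
    exact this.symm
  · intro h ξ
    refine levelPoly_injOn (hG.image ξ) hG ?_
    rw [levelPoly_image hG]
    ext i
    obtain ⟨y, hy⟩ := h i
    rw [coeff_map, ← coord_eq_coeff, ← hy]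
    exact ξ.commutes y

theorem derivative_iterPoly {R : Type*} [CommRing R] (hR : ((Fintype.card Fq : ℕ) : R) = 0)
    (hj : 0 < j) (hm : 0 < m) (gm g : R) (k : ℕ) :
    derivative (iterPoly Fq m j gm g k) = 1 := by
  have h : ∀ i, 0 < i → derivative (X ^ Fintype.card Fq ^ i : Polynomial R) = 0 := by
    intro i hi
    rw [derivative_X_pow, Nat.cast_pow, hR, zero_pow hi.ne', C_0, zero_mul]
  induction k with
  | zero => simp [iterPoly]
  | succ k ih =>
    rw [iterPoly, derivative_comp, ih, phiPoly]
    simp only [derivative_add, derivative_C_mul, h _ hm, h _ hj, derivative_X]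
    simp

/-- Elements of G are roots of φ_(T^(s+1)), a polynomial over L with derivative 1. -/
theorem isSeparable_of_isLevel [IsAlgClosed Ω] (hj : 0 < j) (hm : 0 < m) {gm gj : Ω}
    (hgm : gm ∈ (algebraMap L Ω).range) (hgj : gj ∈ (algebraMap L Ω).range)
    {G : Submodule Fq Ω} (h : IsLevel Fq (phiT Fq m j gm gj) (X ^ (s + 1)) G) {v : Ω}
    (hv : v ∈ G) : IsSeparable L v := by
  obtain ⟨gm, rfl⟩ := hgm
  obtain ⟨gj, rfl⟩ := hgj
  have hL : ((Fintype.card Fq : ℕ) : L) = 0 := (algebraMap L Ω).injective (by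
    rw [map_natCast, map_zero, ← map_natCast (algebraMap Fq Ω), FiniteField.cast_card_eq_zero,
      map_zero])
  have hsep : (iterPoly Fq m j gm gj (s + 1)).Separable := by
    rw [Polynomial.Separable, derivative_iterPoly hL hj hm]
    exact isCoprime_one_right
  refine hsep.of_dvd (minpoly.dvd L v ?_)
  rw [aeval_def, ← eval_map, map_iterPoly, eval_iterPoly]
  simpa using h.1 v hv

variable [IsAlgClosed Ω] [Normal L Ω]

theorem isStable_iff_of_isLevel (hj : 0 < j) (hm : 0 < m) {gm gj : Ω}
    (hgm : gm ∈ (algebraMap L Ω).range) (hgj : gj ∈ (algebraMap L Ω).range)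
    {G : Submodule Fq Ω} (h : IsLevel Fq (phiT Fq m j gm gj) (X ^ (s + 1)) G) :
    IsStable L G ↔ ∀ i, coord (G : Set Ω) i ∈ (algebraMap L Ω).range :=
  isStable_iff (isLevel_finite h) fun _ hv => isSeparable_of_isLevel hj hm hgm hgj h hv

variable (K L) in
/-- The functions that are `L`-valued at `p`. -/
def valuedAt {T : Type*} (p : T) : Subalgebra K (T → Ω) :=
  (IsScalarTower.toAlgHom K L Ω).range.comap (Pi.evalAlgHom K (fun _ => Ω) p)

theorem neg_one_mem_range : (-1 : Ω) ∈ (algebraMap L Ω).range := neg_mem (one_mem _)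

theorem Triple.isOver_iff (hj : 0 < j) (hm : 0 < m) (P : Triple Fq Ω m j (X ^ (s + 1))) :
    P.IsOver L ↔ ∀ f ∈ regDD Fq K Ω m j (X ^ (s + 1)), f P ∈ (algebraMap L Ω).range := by
  constructor
  · rintro ⟨hg, hG, hx⟩
    have hc := (isStable_iff_of_isLevel hj hm neg_one_mem_range hg P.level).1 hG
    have hle : regDD Fq K Ω m j (X ^ (s + 1)) ≤ valuedAt K L P := XDD_adjoin_le hg hx hc
    exact fun f hf => hle hf
  · intro h
    have hg := h _ gj_mem_XDD
    exact ⟨hg, (isStable_iff_of_isLevel hj hm neg_one_mem_range hg P.level).2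
      fun i => h _ (coord_mem_XDD i), h _ x_mem_XDD⟩

theorem NPair.isOver_iff (hj : 0 < j) (hm : 0 < m) (P : NPair Fq Ω m j (X ^ (s + 1))) :
    P.IsOver L ↔ ∀ f ∈ regD Fq K Ω m j (X ^ (s + 1)), f P ∈ (algebraMap L Ω).range := by
  constructor
  · rintro ⟨hg, hG⟩
    have hc := (isStable_iff_of_isLevel hj hm neg_one_mem_range hg P.level).1 hG
    have hle : regD Fq K Ω m j (X ^ (s + 1)) ≤ valuedAt K L P := XD_adjoin_le hg hc
    exact fun f hf => hle hf
  · intro h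
    have hg := h _ gj_mem_XD
    exact ⟨hg, (isStable_iff_of_isLevel hj hm neg_one_mem_range hg P.level).2
      fun i => h _ (coord_mem_XD i)⟩

theorem PairClass.isOver_iff (hj : 0 < j) (hjm : j < m) (hK : Module.finrank Fq K = m)
    (c : PairClass Fq Ω m j (X ^ (s + 1))) : PairClass.IsOver L c ↔
      ∀ f ∈ reg0 Fq K Ω m j (X ^ (s + 1)), f c ∈ (algebraMap L Ω).range := by
  have hm : 0 < m := hj.trans hjm
  constructor
  · rintro ⟨P, rfl, hgm, hg, hG⟩
    have hc := (isStable_iff_of_isLevel hj hm hgm hg P.level).1 hG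
    have hgm' : P.gm⁻¹ ∈ (algebraMap L Ω).range := by
      obtain ⟨a, ha⟩ := hgm
      exact ⟨a⁻¹, by rw [map_inv₀, ha]⟩
    have hle : regPair Fq K Ω m j (X ^ (s + 1)) ≤ valuedAt K L P :=
      pairSpace_adjoin_le hgm hgm' hg hc
    exact fun f hf => hle (mem_reg0.1 hf)
  · intro h
    obtain ⟨y, rfl⟩ := pi3_surjective hj hjm c
    -- An arbitrary representative need not be defined over L. The model is, because its coordinates
    -- are values of regular functions on X.
    have H : ∀ (F : Pair Fq Ω m j (X ^ (s + 1)) → Ω) (w : ℤ), IsHomogeneous F w →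
        F ∈ regPair Fq K Ω m j (X ^ (s + 1)) →
        F (y.model hj hjm) ∈ (algebraMap L Ω).range := by
      intro F w hw hF
      obtain ⟨k, hk, e⟩ := hw.exists_comp_model hj hjm hK hF
      rw [e]
      exact h k hk
    have hgm := H (fun P => P.gm) _ (isHomogeneous_gm hj hjm) gm_mem_pairSpace
    have hg := H (fun P => P.gj) _ (isHomogeneous_gj hj hjm) gj_mem_pairSpace
    exact ⟨y.model hj hjm, y.mk_model hj hjm, hgm, hg,
      (isStable_iff_of_isLevel hj hm hgm hg (y.model hj hjm).level).2 fun i =>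
        H (fun P => coord (P.G : Set Ω) i) _ (isHomogeneous_coord i) (coord_mem_pairSpace i)⟩

end Rationality

end DrinfeldCurve

end

/-! ### The main theorem -/

open DrinfeldCurve
theorem mainTheorem7
    {Fq : Type*} [Field Fq] [Fintype Fq]
    {K : Type*} [Field K] [Algebra Fq K]
    {L : Type*} [Field L] [Algebra K L]
    {Ω : Type*} [Field Ω] [Algebra L Ω] [IsAlgClosure L Ω]
    [Algebra Fq Ω] [Algebra K Ω] [IsScalarTower Fq K Ω] [IsScalarTower K L Ω]
    (j k m n : ℕ) (hj : 0 < j) (hk : 0 < k) (hjk : Nat.Coprime j k)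
    (hm : m = j + k) (hm0 : 0 < m) (hK : Module.finrank Fq K = m)
    (N : Polynomial Fq) (hN : N = Polynomial.X ^ n) (hn : 1 ≤ n) :
    -- The three spaces are affine curves over `K`, with the prescribed `L`-points.
    ((XDD Fq K Ω m j N).IsAffineCurve ∧
      (XD Fq K Ω m j N).IsAffineCurve ∧
      (X0 Fq K Ω m j N).IsAffineCurve ∧
      (∀ P : Triple Fq Ω m j N,
        P.IsOver L ↔ ∀ f ∈ (XDD Fq K Ω m j N).reg, f P ∈ (algebraMap L Ω).range) ∧
      (∀ P : NPair Fq Ω m j N,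
        P.IsOver L ↔ ∀ f ∈ (XD Fq K Ω m j N).reg, f P ∈ (algebraMap L Ω).range) ∧
      (∀ c : PairClass Fq Ω m j N,
        PairClass.IsOver L c ↔ ∀ f ∈ (X0 Fq K Ω m j N).reg, f c ∈ (algebraMap L Ω).range)) ∧
    -- (1)
    ((∀ μ : Kˣ,
        IsMorphism (Y := XDD Fq K Ω m j N) (X := XDD Fq K Ω m j N)
          (scaleHom Fq Ω m j N K hK hm0 μ) ∧
        pi3 Fq Ω m j N ∘ scaleHom Fq Ω m j N K hK hm0 μ = pi3 Fq Ω m j N) ∧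
      (∀ μ : Fqˣ,
        pi1 Fq Ω m j N ∘ scaleHom Fq Ω m j N K hK hm0 (Units.map (algebraMap Fq K : Fq →* K) μ) =
          pi1 Fq Ω m j N)) ∧
    -- (2)
    (IsGaloisCovering (Y := XDD Fq K Ω m j N) (X := XD Fq K Ω m j N) (pi1 Fq Ω m j N)
        ((scaleHom Fq Ω m j N K hK hm0).comp (Units.map (algebraMap Fq K : Fq →* K))) ∧
      IsGaloisOnFunctionFields (Y := XDD Fq K Ω m j N) (X := XD Fq K Ω m j N)
        (pi1 Fq Ω m j N) Fqˣ) ∧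
    -- (3)
    (IsGaloisCovering (Y := XDD Fq K Ω m j N) (X := X0 Fq K Ω m j N) (pi3 Fq Ω m j N)
        (scaleHom Fq Ω m j N K hK hm0) ∧
      IsGaloisOnFunctionFields (Y := XDD Fq K Ω m j N) (X := X0 Fq K Ω m j N)
        (pi3 Fq Ω m j N) Kˣ) := by
  -- With n = s + 1 the socle of G is spanned by T^s z, without subtraction in the exponent.
  obtain ⟨s, rfl⟩ : ∃ s, n = s + 1 := ⟨n - 1, (Nat.sub_add_cancel hn).symm⟩
  subst hN
  have hjm : j < m := by omega
  have : IsAlgClosed Ω := IsAlgClosure.isAlgClosed L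
  have : Normal L Ω := IsAlgClosure.normal L Ω
  have : Module.Finite Fq K := Module.finite_of_finrank_pos (hK ▸ hm0)
  have : Finite K := Module.finite_of_finite Fq
  have h1 := pi1_isGaloisCovering (Ω := Ω) (s := s) hK hm0 hj hjm
  have h3 := pi3_isGaloisCovering (Ω := Ω) (s := s) hK hm0 hj hjm
  exact ⟨⟨XDD_isAffineCurve hj hjm, XD_isAffineCurve hj hjm, X0_isAffineCurve hj hjm hK,
      Triple.isOver_iff hj hm0, NPair.isOver_iff hj hm0, PairClass.isOver_iff hj hjm hK⟩,
    ⟨fun μ => ⟨h3.automorphism μ, funext (pi3_scale hK hm0 μ)⟩,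
      fun μ => funext (pi1_scale_fq hj hjm hK hm0 μ)⟩,
    ⟨h1, h1.isGaloisOnFunctionFields XDD_ev_injective⟩,
    h3, h3.isGaloisOnFunctionFields XDD_ev_injective⟩
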